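/- All graphs are finite and simple, and $\rho(G)$ denotes the largest eigenvalue of the adjacency matrix of $G$. For a graph $F$, let $\mathrm{spex}(n,F)$ be the maximum of $\rho(G)$ over all graphs $G$ of order $n$ that contain no copy of $F$ as a (not necessarily induced) subgraph, and let $\mathrm{SPEX}(n,F)$ be the family of all such graphs with $\rho(G)=\mathrm{spex}(n,F)$; graphs are considered up to isomorphism. For $n>k>0$ and $0\le p\le\lfloor (n-k)/2\rfloor$, let $S_{n,k}^{p}$ be the graph obtained from the join of $K_k$ and $n-k$ isolated vertices by adding $p$ pairwise disjoint edges among these $n-k$ vertices. Put $G_{n,\ell}=S_{n,(\ell-2)/2}^{0}$ if $\ell$ is even and $G_{n,\ell}=S_{n,(\ell-3)/2}^{1}$ if $\ell$ is odd. Let $\ell\ge 6$ and $4\le d\le \ell-1$ be integers. There is an $N=N(\ell,d)$ such that the following hold. (i) If at least one of $\ell$ and $d$ is even, then there exists a tree $F$ of order $\ell$ and diameter $d$ such that $\mathrm{SPEX}(n,F)=\{G_{n,\ell}\}$ for all $n\ge N$. (ii) If both $\ell$ and $d$ are odd, $n\ge N$, and $G$ is a graph of order $n$ with $\rho(G)\ge\rho(S_{n,(\ell-3)/2}^{0})$,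 then $G$ contains all trees of order $\ell$ and diameter $d$ if and only if $G\ne S_{n,(\ell-3)/2}^{0}$; that is, $G$ contains all of them unless $G=S_{n,(\ell-3)/2}^{0}$, and this graph is a genuine exception. -/

import Mathlib

open scoped SimpleGraph

noncomputable section

open scoped Classical in
/-- The spectral radius `ρ(G)`: the largest eigenvalue of the (real symmetric) adjacency matrix
of a finite graph. -/
def graphRho {V : Type*} [Fintype V] (G : SimpleGraph V) : ℝ :=
  sSup (spectrum ℝ (G.adjMatrix ℝ))

/-- `spex(n, F)`: the maximum of `ρ(G)` over all `F`-free graphs `G` of order `n`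
(a supremum over a finite set). -/
def spex {W : Type*} (n : ℕ) (F : SimpleGraph W) : ℝ :=
  sSup {r : ℝ | ∃ G : SimpleGraph (Fin n), F.Free G ∧ graphRho G = r}

/-- `SPEX(n, F)`: the `F`-free graphs of order `n` whose spectral radius is `spex(n, F)`. -/
def SPEX {W : Type*} (n : ℕ) (F : SimpleGraph W) : Set (SimpleGraph (Fin n)) :=
  {G | F.Free G ∧ graphRho G = spex n F}

/-- `S_{n,k}^p`: the join of the complete graph on the vertices `0, …, k-1` with the empty graph
on `k, …, n-1`, together with the `p` independent edges `{k+2t, k+2t+1}`, `t < p`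
(meant for `0 < k < n` and `2 * p ≤ n - k`). -/
def graphS (n k p : ℕ) : SimpleGraph (Fin n) where
  Adj i j := i ≠ j ∧ ((i : ℕ) < k ∨ (j : ℕ) < k ∨
    ∃ t < p, ((i : ℕ) = k + 2 * t ∧ (j : ℕ) = k + 2 * t + 1) ∨
      ((j : ℕ) = k + 2 * t ∧ (i : ℕ) = k + 2 * t + 1))
  symm := ⟨by
    rintro i j ⟨hne, h⟩
    refine ⟨hne.symm, ?_⟩
    rcases h with h | h | ⟨t, ht, h⟩
    · exact Or.inr (Or.inl h)
    · exact Or.inl h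
    · exact Or.inr (Or.inr ⟨t, ht, h.symm⟩)⟩
  loopless := ⟨fun _ h => h.1 rfl⟩

/-- `G_{n,ℓ}`: `S_{n,(ℓ-2)/2}^0` for even `ℓ` and `S_{n,(ℓ-3)/2}^1` for odd `ℓ`. -/
def graphGnl (n l : ℕ) : SimpleGraph (Fin n) :=
  if Even l then graphS n ((l - 2) / 2) 0 else graphS n ((l - 3) / 2) 1

end

/-! Let `k` be `(ℓ-2)/2` or `(ℓ-3)/2`, rounded down, so that `ℓ ≤ 2k+3` and the smaller colour class
of a tree `F` of order `ℓ` has at most `k+1` vertices. Let `G` be `F`-free of large order `n` with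
`ρ(G) ≥ ρ(S_{n,k}^0)`. Greedy embedding shows that every vertex set spans few edges, and that
between a small set and the rest there are at most about `kn` edges. Counting walks of length two
with a Perron vector of maximum one then yields a set `K` of `k` vertices with entries near one and
almost full degree, all other entries being small (`exists_dominating_set`). A Rayleigh quotient
comparison with the join of `K` and an empty graph upgrades this to full degree
(`adj_of_mem_dominating_set`). As `F` has diameter at least three, at most one edge survives outside
`K`, so `G` is `S_{n,k}^0` or `S_{n,k}^1` (`iso_graphS_of_full_set`).

It remains to see which trees these two graphs contain. One edge outside `K` creates `F` if `ℓ ≤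
2k+2`, and also if the diameter is odd, because the ends of a longest path are then leaves in
opposite colour classes. For the other direction a single tree, `spider`, serves all cases: a path
of length `d` with legs of length two, and possibly one leaf, at its vertex `2`. If `d` is odd or `ℓ
= 2k+2` it has a matching of size `k+1`, hence is not in `S_{n,k}^0`. If `ℓ = 2k+3` and `d` is even,
a vertex cover of size `k+1` contains no even vertex, and this rigidity keeps it out of `S_{n,k}^1`.
-/

section SpectralTrees

open Finset
open scoped Classical

/-! ### Greedy embedding of trees -/

/-- A tree embeds in `G` with each vertex `w` sent into a prescribed set `S w`, as soon as every
vertex allowed for `w` has enough neighbours allowed for each neighbour of `w`. -/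
theorem exists_embedding_of_allowed {V : Type*} (G : SimpleGraph V) (m : ℕ) :
    ∀ {W : Type*} [Fintype W] (F : SimpleGraph W), Fintype.card W = m → F.IsTree →
      ∀ S : W → Finset V, (∀ w, (S w).Nonempty) →
      (∀ w w', F.Adj w w' → ∀ v ∈ S w,
        #{w'' | ¬ Disjoint (S w'') (S w')} ≤ #{u ∈ S w' | G.Adj v u}) →
      ∃ f : W → V, Function.Injective f ∧ (∀ w, f w ∈ S w) ∧
        ∀ w w', F.Adj w w' → G.Adj (f w) (f w') := by
  induction m with
  | zero =>
    intro W _ F hc hF S hne h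
    have := hF.connected.nonempty
    exact absurd hc Fintype.card_ne_zero
  | succ m ih =>
    intro W _ F hc hF S hne h
    have hW := hF.connected.nonempty
    rcases subsingleton_or_nontrivial W with hs | hs
    · choose f hf using hne
      exact ⟨f, Function.injective_of_subsingleton f, hf,
        fun w w' hww => absurd (Subsingleton.elim w w') hww.ne⟩
    obtain ⟨u, hu⟩ := hF.exists_vert_degree_one_of_nontrivial
    obtain ⟨u', hu', huniq⟩ := SimpleGraph.degree_eq_one_iff_existsUnique_adj.1 hu
    have hT : (F.induce ({u}ᶜ : Set W)).IsTree :=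
      ⟨hF.connected.induce_compl_singleton_of_degree_eq_one hu, hF.isAcyclic.induce _⟩
    have hcard : Fintype.card ({u}ᶜ : Set W) = m := by
      rw [Fintype.card_compl_set, hc]; simp
    obtain ⟨f', hf'inj, hf'S, hf'adj⟩ := ih (F.induce ({u}ᶜ : Set W)) hcard hT
      (fun w => S w) (fun w => hne w) (by
        intro w w' hww v hv
        refine le_trans ?_ (h w w' hww v hv)
        refine Finset.card_le_card_of_injOn Subtype.val ?_ Subtype.val_injective.injOn
        intro a ha
        simpa using ha)
    have hu'mem : u' ∈ ({u}ᶜ : Set W) := by simpa using hu'.ne'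
    -- The leaf `u` is placed last. The count in `h` includes `u` itself, so the other vertices that
    -- may occupy `S u` are strictly fewer than the allowed neighbours of the image of `u'`, and one
    -- of these is free.
    have hex : ∃ v ∈ ({v ∈ S u | G.Adj (f' ⟨u', hu'mem⟩) v} : Finset V), v ∉ Set.range f' := by
      by_contra hcon
      push Not at hcon
      have h1 := h u' u hu'.symm _ (hf'S ⟨u', hu'mem⟩)
      have h2 : ({v ∈ S u | G.Adj (f' ⟨u', hu'mem⟩) v} : Finset V) ⊆
          ((({w'' | ¬ Disjoint (S w'') (S u)} : Finset W).erase u).attach.image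
            (fun w => f' ⟨w.1, by simpa using (Finset.mem_erase.1 w.2).1⟩)) := by
        intro v hv
        obtain ⟨w, rfl⟩ := hcon v hv
        refine Finset.mem_image.2 ⟨⟨w.1, ?_⟩, Finset.mem_attach _ _, rfl⟩
        refine Finset.mem_erase.2 ⟨fun hw => w.2 hw, ?_⟩
        simp only [Finset.mem_filter, Finset.mem_univ, true_and]
        exact Finset.not_disjoint_iff.2 ⟨_, hf'S w, (Finset.mem_filter.1 hv).1⟩
      have h3 := (Finset.card_le_card h2).trans Finset.card_image_le
      rw [Finset.card_attach, Finset.card_erase_of_mem] at h3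
      · have : 0 < #{w'' | ¬ Disjoint (S w'') (S u)} :=
          Finset.card_pos.2 ⟨u, by simpa [Finset.nonempty_iff_ne_empty] using hne u⟩
        omega
      · simpa [Finset.nonempty_iff_ne_empty] using hne u
    obtain ⟨v, hv, hvr⟩ := hex
    rw [Finset.mem_filter] at hv
    refine ⟨fun w => if hw : w = u then v else f' ⟨w, by simpa using hw⟩, ?_, ?_, ?_⟩
    · intro a b hab
      by_cases ha : a = u <;> by_cases hb : b = u
      · rw [ha, hb]
      · simp only [ha, hb, dite_true, dite_false] at hab
        exact absurd ⟨_, hab.symm⟩ hvr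
      · simp only [ha, hb, dite_true, dite_false] at hab
        exact absurd ⟨_, hab⟩ hvr
      · simp only [ha, hb, dite_false] at hab
        exact congrArg Subtype.val (hf'inj hab)
    · intro w
      by_cases hw : w = u
      · subst hw; simpa using hv.1
      · simpa only [hw, dite_false] using hf'S ⟨w, by simpa using hw⟩
    · intro a b hab
      by_cases ha : a = u <;> by_cases hb : b = u
      · subst ha; subst hb; exact absurd hab (F.loopless.irrefl _)
      · subst ha
        obtain rfl := huniq b hab
        simpa [hb] using hv.2.symm
      · subst hb
        obtain rfl := huniq a hab.symm
        simpa [ha] using hv.2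
      · simp only [ha, hb, dite_false]
        exact hf'adj ⟨a, by simpa using ha⟩ ⟨b, by simpa using hb⟩ hab

/-! ### Sparsity of graphs without a given tree -/

section Sparse

variable {V W : Type*} [Fintype W] {G : SimpleGraph V} {F : SimpleGraph W}

theorem isContained_of_allowed (hF : F.IsTree) (S : W → Finset V) (hne : ∀ w, (S w).Nonempty)
    (h : ∀ w w', F.Adj w w' → ∀ v ∈ S w,
        #{w'' | ¬ Disjoint (S w'') (S w')} ≤ #{u ∈ S w' | G.Adj v u}) : F ⊑ G := by
  obtain ⟨f, hinj, -, hadj⟩ := exists_embedding_of_allowed G _ F rfl hF S hne h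
  exact ⟨⟨⟨f, fun {a b} hab => hadj a b hab⟩, hinj⟩⟩

/-- Minimum degree at least `|W|` inside `S` would allow a greedy embedding with all of `S` allowed
for every vertex. This degeneracy drives the edge bounds below. -/
theorem exists_mem_card_adj_lt (hF : F.IsTree) (hG : F.Free G) {S : Finset V} (hS : S.Nonempty) :
    ∃ v ∈ S, #{u ∈ S | G.Adj v u} < Fintype.card W := by
  by_contra! hcon
  refine hG (isContained_of_allowed hF (fun _ => S) (fun _ => hS) ?_)
  intro w w' _ v hv
  exact (Finset.card_le_univ _).trans (hcon v hv)

/-- Weighted edge bound in graphs without a given tree. -/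
theorem sum_adj_mul_le (hF : F.IsTree) (hG : F.Free G) {x : V → ℝ} {η : ℝ} (S : Finset V)
    (hx0 : ∀ v ∈ S, 0 ≤ x v) (hxη : ∀ v ∈ S, x v ≤ η) :
    ∑ u ∈ S, ∑ v ∈ S, (if G.Adj u v then x u * x v else 0) ≤
      2 * Fintype.card W * η * ∑ u ∈ S, x u := by
  induction hn : #S generalizing S with
  | zero =>
    rw [Finset.card_eq_zero.1 hn]; simp
  | succ n ih =>
    have hS : S.Nonempty := Finset.card_pos.1 (by omega)
    -- Peeling off a vertex of small inner degree removes one row and one column, each of weight at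
    -- most `|W| η x v`; hence the factor two.
    obtain ⟨v, hv, hdeg⟩ := exists_mem_card_adj_lt hF hG hS
    have hη : 0 ≤ η := (hx0 v hv).trans (hxη v hv)
    have hvv : ¬ G.Adj v v := G.loopless.irrefl v
    have hih := ih (S.erase v) (fun u hu => hx0 u (Finset.mem_of_mem_erase hu))
      (fun u hu => hxη u (Finset.mem_of_mem_erase hu)) (by rw [Finset.card_erase_of_mem hv]; omega)
    have hrow : ∑ u ∈ S.erase v, (if G.Adj v u then x v * x u else 0) ≤
        Fintype.card W * η * x v := by
      calc ∑ u ∈ S.erase v, (if G.Adj v u then x v * x u else 0)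
          ≤ ∑ u ∈ S.erase v, (if G.Adj v u then x v * η else 0) := by
            refine Finset.sum_le_sum fun u hu => ?_
            split_ifs
            · exact mul_le_mul_of_nonneg_left (hxη u (Finset.mem_of_mem_erase hu)) (hx0 v hv)
            · exact le_rfl
        _ = #{u ∈ S.erase v | G.Adj v u} * (x v * η) := by
            rw [← Finset.sum_filter, Finset.sum_const, nsmul_eq_mul]
        _ ≤ Fintype.card W * (x v * η) := by
            refine mul_le_mul_of_nonneg_right ?_ (mul_nonneg (hx0 v hv) hη)
            have : #{u ∈ S.erase v | G.Adj v u} ≤ #{u ∈ S | G.Adj v u} :=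
              Finset.card_le_card (Finset.filter_subset_filter _ (Finset.erase_subset _ _))
            exact_mod_cast this.trans hdeg.le
        _ = _ := by ring
    have hsymm : ∑ u ∈ S.erase v, (if G.Adj u v then x u * x v else 0) =
        ∑ u ∈ S.erase v, (if G.Adj v u then x v * x u else 0) :=
      Finset.sum_congr rfl fun u _ => by rw [G.adj_comm, mul_comm]
    have hexp : ∑ u ∈ S, ∑ w ∈ S, (if G.Adj u w then x u * x w else 0) =
        ∑ u ∈ S.erase v, ∑ w ∈ S.erase v, (if G.Adj u w then x u * x w else 0) +
        2 * ∑ u ∈ S.erase v, (if G.Adj v u then x v * x u else 0) := by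
      rw [← Finset.add_sum_erase S _ hv]
      simp_rw [← Finset.add_sum_erase S _ hv]
      rw [Finset.sum_add_distrib, hsymm, if_neg hvv]
      ring
    rw [hexp, ← Finset.add_sum_erase S x hv]
    linarith

theorem sum_card_adj_le (hF : F.IsTree) (hG : F.Free G) (S : Finset V) :
    ∑ u ∈ S, (#{v ∈ S | G.Adj u v} : ℝ) ≤ 2 * Fintype.card W * #S := by
  have := sum_adj_mul_le hF hG (x := fun _ => 1) (η := 1) S (by simp) (by simp)
  simpa [Finset.sum_ite] using this

/-- Edge bound between two disjoint sets in graphs without a given tree. -/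
theorem sum_card_adj_between_le (hF : F.IsTree) (hG : F.Free G) {A : Finset W} {k : ℕ}
    (hA : ∀ w w', F.Adj w w' → (w ∈ A ↔ w' ∉ A)) (hAk : #A ≤ k + 1) (P Q : Finset V)
    (hPQ : Disjoint P Q) :
    ∑ q ∈ Q, #{p ∈ P | G.Adj q p} ≤ k * #Q + Fintype.card W * #P := by
  induction hn : #P + #Q generalizing P Q with
  | zero =>
    have : Q = ∅ := Finset.card_eq_zero.1 (by omega)
    simp [this]
  | succ n ih =>
    by_cases hq : ∃ q ∈ Q, #{p ∈ P | G.Adj q p} ≤ k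
    · obtain ⟨q, hq, hqk⟩ := hq
      have := ih P (Q.erase q) (hPQ.mono_right (Finset.erase_subset _ _))
        (by rw [Finset.card_erase_of_mem hq]; have := Finset.card_pos.2 ⟨q, hq⟩; omega)
      rw [← Finset.add_sum_erase Q _ hq, ← Finset.card_erase_add_one hq]
      linarith
    by_cases hp : ∃ p ∈ P, #{q ∈ Q | G.Adj p q} ≤ Fintype.card W
    · obtain ⟨p, hp, hpk⟩ := hp
      have h1 := ih (P.erase p) Q (hPQ.mono_left (Finset.erase_subset _ _))
        (by rw [Finset.card_erase_of_mem hp]; have := Finset.card_pos.2 ⟨p, hp⟩; omega)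
      have h2 : ∑ q ∈ Q, #{p ∈ P | G.Adj q p} =
          ∑ q ∈ Q, #{p ∈ P.erase p | G.Adj q p} + #{q ∈ Q | G.Adj p q} := by
        rw [Finset.card_filter, ← Finset.sum_add_distrib]
        refine Finset.sum_congr rfl fun q _ => ?_
        rw [Finset.card_filter, Finset.card_filter, ← Finset.add_sum_erase P _ hp, add_comm,
          G.adj_comm]
      rw [h2, ← Finset.card_erase_add_one hp]
      linarith
    -- Nothing can be peeled off any more. Sending `A` into `P` and the rest into `Q` then works:
    -- only the at most `k + 1` vertices of `A` compete for places in `P`, and every vertex of `Q`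
    -- has more than `k` neighbours there.
    push Not at hq hp
    exfalso
    have hne : P.Nonempty ∧ Q.Nonempty := by
      by_cases hP : P.Nonempty
      · obtain ⟨p, hp'⟩ := hP
        refine ⟨⟨p, hp'⟩, ?_⟩
        obtain ⟨q, hq⟩ := Finset.card_pos.1 ((Nat.zero_le _).trans_lt (hp p hp'))
        exact ⟨q, (Finset.mem_filter.1 hq).1⟩
      · have hP' := Finset.not_nonempty_iff_eq_empty.1 hP
        have hQ : Q.Nonempty := Finset.card_pos.1 (by rw [hP'] at hn; simp at hn; omega)
        obtain ⟨q, hq'⟩ := hQ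
        have := hq q hq'
        simp [hP'] at this
    refine hG (isContained_of_allowed hF (fun w => if w ∈ A then P else Q) ?_ ?_)
    · intro w; split_ifs; exacts [hne.1, hne.2]
    · intro w w' hww v hv
      by_cases hw : w ∈ A
      · have hw' : w' ∉ A := (hA w w' hww).1 hw
        simp only [hw, hw', if_true, if_false] at hv ⊢
        exact (Finset.card_le_univ _).trans (hp v hv).le
      · have hw' : w' ∈ A := by by_contra h; exact hw ((hA w w' hww).2 h)
        simp only [hw, hw', if_true, if_false] at hv ⊢
        refine le_trans (Finset.card_le_card (t := A) ?_) (hAk.trans (hq v hv))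
        intro w'' h''
        by_contra hcon
        simp [hcon, hPQ.symm] at h''

end Sparse

/-! ### Colour classes and leaves of trees -/

section Leaves

variable {W : Type*} {F : SimpleGraph W}

/-- In a tree, the vertices at even distance from `r` form a colour class. -/
theorem SimpleGraph.IsTree.even_dist_iff [Fintype W] (hF : F.IsTree) (r : W) {w w' : W} (h : F.Adj w w') :
    w ∈ ({v | Even (F.dist r v)} : Finset W) ↔ w' ∉ ({v | Even (F.dist r v)} : Finset W) := by
  simp only [Finset.mem_filter, Finset.mem_univ, true_and]
  rcases hF.dist_eq_dist_add_one_of_adj r h with h | h <;> rw [h, Nat.even_add_one]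
  exact not_not.symm

/-- One of two complementary colour classes of a tree contains at most half of the vertices outside
a given set. -/
theorem SimpleGraph.IsTree.exists_colorClass [Fintype W] (hF : F.IsTree) (X : Finset W) :
    ∃ A : Finset W, (∀ w w', F.Adj w w' → (w ∈ A ↔ w' ∉ A)) ∧
      2 * #(A \ X) + #X ≤ Fintype.card W := by
  obtain ⟨r⟩ := hF.connected.nonempty
  set A : Finset W := {v | Even (F.dist r v)} with hA
  have hadj : ∀ w w', F.Adj w w' → (w ∈ A ↔ w' ∉ A) := fun w w' h => hF.even_dist_iff r h
  have hsum : #(A \ X) + #(Aᶜ \ X) + #X = Fintype.card W := by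
    rw [← Finset.card_union_of_disjoint, ← Finset.card_union_of_disjoint, ← Finset.card_univ]
    · congr 1; ext w; simp; tauto
    · rw [Finset.disjoint_left]; intro w; simp; tauto
    · rw [Finset.disjoint_left]; intro w; simp; tauto
  rcases le_total #(A \ X) #(Aᶜ \ X) with h | h
  · exact ⟨A, hadj, by omega⟩
  · refine ⟨Aᶜ, fun w w' hww => ?_, by omega⟩
    have := hadj w w' hww
    simp only [Finset.mem_compl]; tauto

/-- The ends of a longest path in a tree are leaves. -/
theorem SimpleGraph.IsTree.existsUnique_adj_of_dist_eq_diam (hF : F.IsTree) {u v : W}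
    (huv : F.dist u v = F.diam) (hd : F.diam ≠ 0) : ∃! w, F.Adj v w := by
  have htop := SimpleGraph.ediam_ne_top_of_diam_ne_zero hd
  have hdist : ∀ w, F.Adj v w → F.dist u v = F.dist u w + 1 := by
    intro w hw
    rcases hF.dist_eq_dist_add_one_of_adj u hw with h | h
    · exact h
    · have := SimpleGraph.dist_le_diam htop (u := u) (v := w)
      omega
  -- No neighbour of `v` is farther from `u` than `v` is, so each neighbour is the last but one
  -- vertex of a shortest, hence of the unique, path from `u` to `v`.
  have hkey : ∀ w, F.Adj v w → ∃ p : F.Walk u v, p.IsPath ∧ p.penultimate = w := by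
    intro w hw
    obtain ⟨p, hp⟩ := hF.connected.exists_walk_length_eq_dist u w
    refine ⟨p.concat hw.symm, SimpleGraph.Walk.isPath_of_length_eq_dist _ ?_, by simp⟩
    rw [SimpleGraph.Walk.length_concat, hp, hdist w hw]
  obtain ⟨w, hw⟩ : ∃ w, F.Adj v w := by
    obtain ⟨p, hp⟩ := hF.connected.exists_walk_length_eq_dist v u
    cases p with
    | nil => simp at huv; exact absurd huv.symm hd
    | cons h _ => exact ⟨_, h⟩
  refine ⟨w, hw, fun w' hw' => ?_⟩
  obtain ⟨p, hp, rfl⟩ := hkey w hw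
  obtain ⟨q, hq, rfl⟩ := hkey w' hw'
  rw [(hF.existsUnique_path u v).unique hp hq]

/-- A tree of diameter at least three has two leaves with distinct neighbours. -/
theorem SimpleGraph.IsTree.exists_two_leaves (hF : F.IsTree) (hd : 3 ≤ F.diam) :
    ∃ x y x' y' : W, (∀ w, F.Adj x w ↔ w = y) ∧ (∀ w, F.Adj x' w ↔ w = y') ∧
      x ≠ x' ∧ y ≠ y' ∧ x ≠ y' ∧ x' ≠ y := by
  have := hF.connected.nonempty
  obtain ⟨u, v, huv⟩ := F.exists_dist_eq_diam
  obtain ⟨y', hy', hu'⟩ := hF.existsUnique_adj_of_dist_eq_diam huv (by omega)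
  obtain ⟨y, hy, hu⟩ := hF.existsUnique_adj_of_dist_eq_diam (u := v) (v := u)
    (by rw [SimpleGraph.dist_comm]; exact huv) (by omega)
  have h1 : F.dist u y = 1 := SimpleGraph.dist_eq_one_iff_adj.2 hy
  have h2 : F.dist v y' = 1 := SimpleGraph.dist_eq_one_iff_adj.2 hy'
  have h3 := hF.connected.dist_triangle (u := u) (v := y) (w := v)
  have h4 := hF.connected.dist_triangle (u := u) (v := y') (w := v)
  rw [SimpleGraph.dist_comm (u := y') (v := v)] at h4
  refine ⟨u, y, v, y', fun w => ⟨hu w, fun h => h ▸ hy⟩, fun w => ⟨hu' w, fun h => h ▸ hy'⟩,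
    ?_, ?_, ?_, ?_⟩
  · rintro rfl; simp at huv; omega
  · rintro rfl; rw [SimpleGraph.dist_comm] at h2; omega
  · rintro rfl; rw [SimpleGraph.dist_comm] at h2; omega
  · rintro rfl; omega

end Leaves

/-! ### Embedding trees around a complete bipartite graph -/

section Embeddings

variable {V W : Type*} [Fintype W] {G : SimpleGraph V} {F : SimpleGraph W} {K R : Finset V}

/-- Embedding of a tree into a graph containing a large complete bipartite graph between `K` and
`R`, where an independent set `C` goes to `K` and the edges missing `C` are placed by hand. -/
theorem isContained_of_cover (hF : F.IsTree) (hKR : ∀ u ∈ K, ∀ v ∈ R, G.Adj u v)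
    (C X : Finset W) (g : W → V) (hCX : Disjoint C X) (hg : Set.InjOn g X)
    (hgK : ∀ w ∈ X, g w ∉ K) (hCK : #C ≤ #K) (hR : 2 * Fintype.card W ≤ #R)
    (hC : ∀ w ∈ C, ∀ w' ∈ C, ¬ F.Adj w w')
    (hX : ∀ w w', F.Adj w w' → w ∉ C → w' ∉ C → w ∈ X ∧ w' ∈ X ∧ G.Adj (g w) (g w'))
    (hgR : ∀ w ∈ C, ∀ w' ∈ X, F.Adj w w' → g w' ∈ R) : F ⊑ G := by
  have hWpos : 0 < Fintype.card W := Fintype.card_pos_iff.2 hF.connected.nonempty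
  have hdKR : Disjoint K R := by
    rw [Finset.disjoint_left]
    exact fun u hu hu' => G.loopless.irrefl u (hKR u hu u hu')
  -- The factor two in `hR` leaves `|W|` free places in `R` after the image of `X` is reserved.
  have hR' : Fintype.card W ≤ #(R \ X.image g) := by
    have h1 := Finset.le_card_sdiff (X.image g) R
    have h2 : #(X.image g) ≤ Fintype.card W := Finset.card_image_le.trans (Finset.card_le_univ _)
    omega
  have hXC : ∀ w ∈ X, w ∉ C := fun w hw hw' => Finset.disjoint_left.1 hCX hw' hw
  set S : W → Finset V := fun w => if w ∈ C then K else if w ∈ X then {g w} else R \ X.image g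
    with hS
  have hSC : ∀ w ∈ C, S w = K := fun w hw => by simp [hS, hw]
  have hSX : ∀ w ∈ X, S w = {g w} := fun w hw => by simp [hS, hw, hXC w hw]
  have hSR : ∀ w, w ∉ C → w ∉ X → S w = R \ X.image g := fun w hw hw' => by simp [hS, hw, hw']
  refine isContained_of_allowed hF S ?_ ?_
  · intro w
    by_cases hw : w ∈ C
    · rw [hSC w hw]
      exact Finset.card_pos.1 ((Finset.card_pos.2 ⟨w, hw⟩).trans_le hCK)
    by_cases hw' : w ∈ X
    · rw [hSX w hw']; simp
    · rw [hSR w hw hw']; exact Finset.card_pos.1 (hWpos.trans_le hR')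
  · intro w w' hww v hv
    by_cases hw'C : w' ∈ C
    · have hwC : w ∉ C := fun h => hC w h w' hw'C hww
      have hvR : v ∈ R := by
        by_cases hwX : w ∈ X
        · rw [hSX w hwX, Finset.mem_singleton] at hv
          rw [hv]; exact hgR w' hw'C w hwX hww.symm
        · rw [hSR w hwC hwX] at hv; exact (Finset.mem_sdiff.1 hv).1
      rw [hSC w' hw'C, Finset.filter_true_of_mem (fun u hu => (hKR u hu v hvR).symm)]
      refine (Finset.card_le_card (t := C) ?_).trans hCK
      intro w'' h''
      by_contra hcon
      refine (Finset.mem_filter.1 h'').2 ?_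
      by_cases hX'' : w'' ∈ X
      · rw [hSX w'' hX'', Finset.disjoint_singleton_left]; exact hgK w'' hX''
      · rw [hSR w'' hcon hX'']; exact (hdKR.symm).mono_left Finset.sdiff_subset
    by_cases hw'X : w' ∈ X
    · have hadj : G.Adj v (g w') := by
        by_cases hwC : w ∈ C
        · rw [hSC w hwC] at hv; exact hKR v hv _ (hgR w hwC w' hw'X hww)
        · obtain ⟨hwX, -, h⟩ := hX w w' hww hwC hw'C
          rw [hSX w hwX, Finset.mem_singleton] at hv
          rwa [hv]
      have h1 : #{u ∈ S w' | G.Adj v u} = 1 := by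
        rw [hSX w' hw'X, Finset.filter_true_of_mem (by simpa using hadj)]; simp
      rw [h1, ← Finset.card_singleton w']
      refine Finset.card_le_card fun w'' h'' => ?_
      have h2 := (Finset.mem_filter.1 h'').2
      rw [hSX w' hw'X, Finset.disjoint_singleton_right, not_not] at h2
      rw [Finset.mem_singleton]
      by_cases hC'' : w'' ∈ C
      · rw [hSC w'' hC''] at h2; exact absurd h2 (hgK w' hw'X)
      by_cases hX'' : w'' ∈ X
      · rw [hSX w'' hX'', Finset.mem_singleton] at h2; exact hg hX'' hw'X h2.symm
      · rw [hSR w'' hC'' hX''] at h2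
        exact absurd (Finset.mem_image_of_mem g hw'X) (Finset.mem_sdiff.1 h2).2
    · have hwC : w ∈ C := by
        by_contra hwC
        exact hw'X (hX w w' hww hwC hw'C).2.1
      rw [hSC w hwC] at hv
      rw [hSR w' hw'C hw'X, Finset.filter_true_of_mem
        (fun u hu => hKR v hv u (Finset.mem_sdiff.1 hu).1)]
      exact (Finset.card_le_univ _).trans hR'

theorem isContained_of_complete_bipartite (hF : F.IsTree) (hKR : ∀ u ∈ K, ∀ v ∈ R, G.Adj u v)
    (hR : 2 * Fintype.card W ≤ #R) {A : Finset W} (hA : ∀ w w', F.Adj w w' → (w ∈ A ↔ w' ∉ A))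
    (hAK : #A ≤ #K) : F ⊑ G := by
  obtain ⟨r⟩ := hF.connected.nonempty
  by_cases hne : Nonempty V
  · obtain ⟨v⟩ := hne
    refine isContained_of_cover hF hKR A ∅ (fun _ => v) (by simp) (by simp) (by simp) hAK hR
      ?_ ?_ (by simp)
    · intro w hw w' hw' h; exact (hA w w' h).1 hw hw'
    · intro w w' h hw hw'; exact absurd ((hA w w' h).2 hw') hw
  · have : R = ∅ := Finset.eq_empty_of_forall_notMem fun v => (hne ⟨v⟩).elim
    have hpos : 0 < Fintype.card W := Fintype.card_pos_iff.2 ⟨r⟩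
    rw [this] at hR; simp at hR; omega

/-- A path of length two with ends in `R` and its midpoint outside `K` creates every tree of order
at most `2 |K| + 3`. -/
theorem isContained_of_cherry (hF : F.IsTree) (hW : Fintype.card W ≤ 2 * #K + 3)
    (hKR : ∀ u ∈ K, ∀ v ∈ R, G.Adj u v) (hR : 2 * Fintype.card W ≤ #R)
    {v r r' : V} (hvK : v ∉ K) (hr : r ∈ R) (hr' : r' ∈ R) (hrr : r ≠ r')
    (hvr : G.Adj v r) (hvr' : G.Adj v r') : F ⊑ G := by
  have hRK : ∀ u ∈ R, u ∉ K := fun u hu hu' => G.loopless.irrefl u (hKR u hu' u hu)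
  obtain ⟨A, hA, hcard⟩ := hF.exists_colorClass ∅
  simp only [Finset.sdiff_empty, Finset.card_empty, add_zero] at hcard
  by_cases hAK : #A ≤ #K
  · exact isContained_of_complete_bipartite hF hKR hR hA hAK
  have hbip : F.IsBipartiteWith (A : Set W) ((Aᶜ : Finset W) : Set W) := by
    refine ⟨by simpa using disjoint_compl_right, fun w w' h => ?_⟩
    have := hA w w' h
    simp; tauto
  have hsum := SimpleGraph.isBipartiteWith_sum_degrees_eq_card_edges hbip
  have hedge := hF.card_edgeFinset
  -- Here `#A` is at least `#K + 1`, while the degrees over `A` sum to `|W| - 1`, at most `2 #K +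
  -- 2`; they cannot all be three or more. The vertex `a` goes to `v` and its at most two neighbours
  -- to `r` and `r'`, which saves one place in `K`.
  obtain ⟨a, haA, hdeg⟩ : ∃ a ∈ A, F.degree a ≤ 2 := by
    by_contra! hcon
    have := Finset.card_nsmul_le_sum A (fun a => F.degree a) 3 (fun a ha => hcon a ha)
    rw [hsum, smul_eq_mul] at this
    omega
  obtain ⟨b, hb⟩ : ∃ b, ∀ w w', F.Adj a w → F.Adj a w' → w ≠ b → w' ≠ b → w = w' := by
    by_cases hN : (F.neighborFinset a).Nonempty
    · obtain ⟨b, hb⟩ := hN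
      refine ⟨b, fun w w' hw hw' hwb hwb' => ?_⟩
      have : #((F.neighborFinset a).erase b) ≤ 1 := by
        rw [Finset.card_erase_of_mem hb]; have : #(F.neighborFinset a) ≤ 2 := hdeg
        omega
      exact Finset.card_le_one.1 this w (by simp [hwb, hw]) w' (by simp [hwb', hw'])
    · refine ⟨a, fun w w' hw => absurd ⟨w, by simpa using hw⟩ hN⟩
  have hmem : ∀ w, w ∈ insert a (F.neighborFinset a) ↔ w = a ∨ F.Adj a w := by simp
  have hvne : v ≠ r := hvr.ne
  have hvne' : v ≠ r' := hvr'.ne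
  refine isContained_of_cover hF hKR (A.erase a) (insert a (F.neighborFinset a))
    (fun w => if w = a then v else if w = b then r else r') ?_ ?_ ?_ ?_ hR ?_ ?_ ?_
  · rw [Finset.disjoint_left]
    intro w hw hw'
    rcases (hmem w).1 hw' with rfl | h
    · simp at hw
    · exact (hA a w h).1 haA (Finset.mem_of_mem_erase hw)
  · intro w hw w' hw' h
    have hw := (hmem w).1 hw
    have hw' := (hmem w').1 hw'
    have := hb w w'
    dsimp only at h
    grind
  · intro w hw
    have := hRK r hr
    have := hRK r' hr'
    grind
  · rw [Finset.card_erase_of_mem haA]; omega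
  · intro w hw w' hw' h
    exact (hA w w' h).1 (Finset.mem_of_mem_erase hw) (Finset.mem_of_mem_erase hw')
  · intro w w' h hw hw'
    have h1 := hA w w' h
    have h2 := h.ne
    have h3 := h.symm
    rw [hmem, hmem]
    rw [Finset.mem_erase] at hw hw'
    have := hvr.symm
    have := hvr'.symm
    grind
  · intro w hw w' hw' h
    have h1 := (hA w w' h).1 (Finset.mem_of_mem_erase hw)
    have h2 : w' ≠ a := by rintro rfl; exact h1 haA
    rw [if_neg h2]
    split_ifs
    exacts [hr, hr']

/-- Two disjoint edges in `R` create every tree of order at most `2 |K| + 3` and diameter at least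
three. -/
theorem isContained_of_two_edges (hF : F.IsTree) (hd : 3 ≤ F.diam)
    (hW : Fintype.card W ≤ 2 * #K + 3) (hKR : ∀ u ∈ K, ∀ v ∈ R, G.Adj u v)
    (hR : 2 * Fintype.card W ≤ #R) {a b a' b' : V} (ha : a ∈ R) (hb : b ∈ R) (ha' : a' ∈ R)
    (hb' : b' ∈ R) (hab : G.Adj a b) (hab' : G.Adj a' b') (h1 : a ≠ a') (h2 : b ≠ b')
    (h3 : a ≠ b') (h4 : b ≠ a') : F ⊑ G := by
  have hRK : ∀ u ∈ R, u ∉ K := fun u hu hu' => G.loopless.irrefl u (hKR u hu' u hu)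
  obtain ⟨x, y, x', y', hx, hx', hxx, hyy, hxy', hxy⟩ := hF.exists_two_leaves hd
  -- Discarding both leaves gives `2 #(A \ {x, x'}) + 2 ≤ 2 #K + 3`, so the rest of the class fits
  -- into `K`; the leaf edges that lose their cover go to the two given edges.
  obtain ⟨A, hA, hcard⟩ := hF.exists_colorClass {x, x'}
  rw [Finset.card_pair hxx] at hcard
  have hn1 : x ≠ y := fun h => F.loopless.irrefl x ((hx x).2 h)
  have hn2 : x' ≠ y' := fun h => F.loopless.irrefl x' ((hx' x').2 h)
  have hn3 := hab.ne
  have hn4 := hab'.ne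
  have hmemC : ∀ w, w ∈ A \ {x, x'} ↔ w ∈ A ∧ w ≠ x ∧ w ≠ x' := by intro w; simp
  have hmemX : ∀ w, w ∈ ({x, y, x', y'} : Finset W) \ (A \ {x, x'}) ↔
      (w = x ∨ w = y ∨ w = x' ∨ w = y') ∧ ¬ (w ∈ A ∧ w ≠ x ∧ w ≠ x') := by
    intro w; rw [Finset.mem_sdiff, hmemC]; simp
  refine isContained_of_cover hF hKR (A \ {x, x'}) ({x, y, x', y'} \ (A \ {x, x'}))
    (fun w => if w = x then a else if w = y then b else if w = x' then a' else b')
    Finset.disjoint_sdiff ?_ ?_ (by omega) hR ?_ ?_ ?_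
  · intro w hw w' hw' h
    have hw := ((hmemX w).1 hw).1
    have hw' := ((hmemX w').1 hw').1
    dsimp only at h
    grind
  · intro w _
    have := hRK a ha
    have := hRK b hb
    have := hRK a' ha'
    have := hRK b' hb'
    grind
  · intro w hw w' hw' h
    exact (hA w w' h).1 ((hmemC w).1 hw).1 ((hmemC w').1 hw').1
  · intro w w' h hw hw'
    have e1 := hA w w' h
    have e2 := h.symm
    have e3 := hx w'
    have e4 := hx w
    have e5 := hx' w
    have e6 := hx' w'
    have e7 := hab.symm
    have e8 := hab'.symm
    rw [hmemX, hmemX]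
    rw [hmemC] at hw hw'
    grind
  · intro w _ w' _ _
    split_ifs <;> assumption

/-- A single edge in `R` creates a tree that has a leaf `x` and an independent set of size `|K|`
covering all edges but the one at `x`. -/
theorem isContained_of_edge_of_leaf (hF : F.IsTree) (hKR : ∀ u ∈ K, ∀ v ∈ R, G.Adj u v)
    (hR : 2 * Fintype.card W ≤ #R) {a b : V} (ha : a ∈ R) (hb : b ∈ R) (hab : G.Adj a b)
    {x y : W} (hx : ∀ w, F.Adj x w ↔ w = y) {A : Finset W}
    (hA : ∀ w w', F.Adj w w' → (w ∈ A ↔ w' ∉ A)) (hAK : #(A \ {x}) ≤ #K) : F ⊑ G := by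
  have hRK : ∀ u ∈ R, u ∉ K := fun u hu hu' => G.loopless.irrefl u (hKR u hu' u hu)
  have hn1 : x ≠ y := fun h => F.loopless.irrefl x ((hx x).2 h)
  have hn3 := hab.ne
  have hmemC : ∀ w, w ∈ A \ {x} ↔ w ∈ A ∧ w ≠ x := by intro w; simp
  have hmemX : ∀ w, w ∈ ({x, y} : Finset W) \ (A \ {x}) ↔
      (w = x ∨ w = y) ∧ ¬ (w ∈ A ∧ w ≠ x) := by
    intro w; rw [Finset.mem_sdiff, hmemC]; simp
  refine isContained_of_cover hF hKR (A \ {x}) ({x, y} \ (A \ {x}))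
    (fun w => if w = x then a else b) Finset.disjoint_sdiff ?_ ?_ hAK hR ?_ ?_ ?_
  · intro w hw w' hw' h
    have hw := ((hmemX w).1 hw).1
    have hw' := ((hmemX w').1 hw').1
    dsimp only at h
    grind
  · intro w _
    have := hRK a ha
    have := hRK b hb
    grind
  · intro w hw w' hw' h
    exact (hA w w' h).1 ((hmemC w).1 hw).1 ((hmemC w').1 hw').1
  · intro w w' h hw hw'
    have e1 := hA w w' h
    have e2 := h.symm
    have e3 := hx w'
    have e4 := hx w
    have e7 := hab.symm
    rw [hmemX, hmemX]
    rw [hmemC] at hw hw'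
    grind
  · intro w _ w' _ _
    split_ifs <;> assumption

theorem isContained_of_edge_of_card_le (hF : F.IsTree) (hd : 3 ≤ F.diam)
    (hW : Fintype.card W ≤ 2 * #K + 2) (hKR : ∀ u ∈ K, ∀ v ∈ R, G.Adj u v)
    (hR : 2 * Fintype.card W ≤ #R) {a b : V} (ha : a ∈ R) (hb : b ∈ R) (hab : G.Adj a b) :
    F ⊑ G := by
  obtain ⟨x, y, -, -, hx, -⟩ := hF.exists_two_leaves hd
  obtain ⟨A, hA, hcard⟩ := hF.exists_colorClass {x}
  rw [Finset.card_singleton] at hcard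
  exact isContained_of_edge_of_leaf hF hKR hR ha hb hab hx hA (by omega)

/-- In odd diameter the two ends of a longest path are leaves of different colours, so the smaller
class, of size at most `#K + 1`, contains one of them; deleting that leaf leaves at most `#K`
vertices. -/
theorem isContained_of_edge_of_odd_diam (hF : F.IsTree) (hd : Odd F.diam)
    (hW : Fintype.card W ≤ 2 * #K + 3) (hKR : ∀ u ∈ K, ∀ v ∈ R, G.Adj u v)
    (hR : 2 * Fintype.card W ≤ #R) {a b : V} (ha : a ∈ R) (hb : b ∈ R) (hab : G.Adj a b) :
    F ⊑ G := by
  have := hF.connected.nonempty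
  have hd0 : F.diam ≠ 0 := by rintro h; rw [h] at hd; exact absurd hd (by decide)
  obtain ⟨u, v, huv⟩ := F.exists_dist_eq_diam
  obtain ⟨y', hy', hu'⟩ := hF.existsUnique_adj_of_dist_eq_diam huv hd0
  obtain ⟨y, hy, hu⟩ := hF.existsUnique_adj_of_dist_eq_diam (u := v) (v := u)
    (by rw [SimpleGraph.dist_comm]; exact huv) hd0
  set A : Finset W := {w | Even (F.dist u w)} with hAdef
  have hA : ∀ w w', F.Adj w w' → (w ∈ A ↔ w' ∉ A) := fun w w' h => hF.even_dist_iff u h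
  have hA' : ∀ w w', F.Adj w w' → (w ∈ Aᶜ ↔ w' ∉ Aᶜ) := by
    intro w w' h
    have := hA w w' h
    simp only [Finset.mem_compl]; tauto
  have huA : u ∈ A := by simp [hAdef]
  have hvA : v ∈ Aᶜ := by simp [hAdef, huv, hd]
  have hsum : #A + #Aᶜ = Fintype.card W := Finset.card_add_card_compl A
  rcases le_total #A #Aᶜ with h | h
  · refine isContained_of_edge_of_leaf hF hKR hR ha hb hab
      (fun w => ⟨hu w, fun h => h ▸ hy⟩) hA ?_
    rw [Finset.sdiff_singleton_eq_erase, Finset.card_erase_of_mem huA]; omega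
  · refine isContained_of_edge_of_leaf hF hKR hR ha hb hab
      (fun w => ⟨hu' w, fun h => h ▸ hy'⟩) hA' ?_
    rw [Finset.sdiff_singleton_eq_erase, Finset.card_erase_of_mem hvA]; omega

end Embeddings

/-! ### Rayleigh quotients and Perron vectors -/

section Spectral

variable {V : Type*} [Fintype V]

theorem finite_spectrum_adjMatrix (G : SimpleGraph V) :
    (spectrum ℝ (G.adjMatrix ℝ)).Finite := by
  have hA : (G.adjMatrix ℝ).IsHermitian := by
    rw [Matrix.IsHermitian, Matrix.conjTranspose_eq_transpose_of_trivial]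
    exact G.isSymm_adjMatrix
  rw [hA.spectrum_real_eq_range_eigenvalues]
  exact Set.finite_range _

theorem dotProduct_rho_sub_adjMatrix (G : SimpleGraph V) (r : ℝ) (y : V → ℝ) :
    star y ⬝ᵥ (algebraMap ℝ (Matrix V V ℝ) r - G.adjMatrix ℝ).mulVec y =
      r * ∑ u, y u ^ 2 - ∑ u, ∑ v, (if G.Adj u v then y u * y v else 0) := by
  rw [Matrix.sub_mulVec, dotProduct_sub, Algebra.algebraMap_eq_smul_one, Matrix.smul_mulVec,
    Matrix.one_mulVec, dotProduct_smul]
  congr 1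
  · simp [dotProduct, pow_two]
  · simp only [dotProduct, Matrix.mulVec, SimpleGraph.adjMatrix_apply, star_trivial,
      Finset.mul_sum]
    refine Finset.sum_congr rfl fun u _ => Finset.sum_congr rfl fun v _ => ?_
    split_ifs <;> simp

/-- Semidefiniteness gives the Rayleigh inequality, and also that vectors attaining equality are
eigenvectors, which produces the Perron vector. -/
theorem posSemidef_rho_sub_adjMatrix (G : SimpleGraph V) :
    (algebraMap ℝ (Matrix V V ℝ) (graphRho G) - G.adjMatrix ℝ).PosSemidef := by
  rw [Matrix.posSemidef_iff_isHermitian_and_spectrum_nonneg]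
  constructor
  · rw [Matrix.IsHermitian, Matrix.conjTranspose_eq_transpose_of_trivial, Matrix.transpose_sub,
      SimpleGraph.transpose_adjMatrix, Algebra.algebraMap_eq_smul_one, Matrix.transpose_smul,
      Matrix.transpose_one]
  · rw [← spectrum.singleton_sub_eq]
    rintro _ ⟨r, hr, s, hs, rfl⟩
    rw [Set.mem_singleton_iff] at hr
    subst hr
    exact sub_nonneg.2 (le_csSup (finite_spectrum_adjMatrix G).bddAbove hs)

theorem sum_adj_le_rho_mul (G : SimpleGraph V) (y : V → ℝ) :
    ∑ u, ∑ v, (if G.Adj u v then y u * y v else 0) ≤ graphRho G * ∑ u, y u ^ 2 := by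
  have := (posSemidef_rho_sub_adjMatrix G).dotProduct_mulVec_nonneg y
  rw [dotProduct_rho_sub_adjMatrix] at this
  linarith

/-- The spectral radius has a nonnegative eigenvector with maximal entry one. -/
theorem exists_perron_vector [Nonempty V] (G : SimpleGraph V) :
    ∃ x : V → ℝ, (∀ v, 0 ≤ x v) ∧ (∀ v, x v ≤ 1) ∧ (∃ z, x z = 1) ∧
      ∀ v, graphRho G * x v = ∑ u, if G.Adj v u then x u else 0 := by
  have hA : (G.adjMatrix ℝ).IsHermitian := by
    rw [Matrix.IsHermitian, Matrix.conjTranspose_eq_transpose_of_trivial]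
    exact G.isSymm_adjMatrix
  have hmem : graphRho G ∈ spectrum ℝ (G.adjMatrix ℝ) := by
    refine Set.Nonempty.csSup_mem ?_ (finite_spectrum_adjMatrix G)
    rw [hA.spectrum_real_eq_range_eigenvalues]
    exact Set.range_nonempty _
  obtain ⟨i, hi⟩ := hA.spectrum_real_eq_range_eigenvalues ▸ hmem
  set b : V → ℝ := ⇑(hA.eigenvectorBasis i) with hb
  have hbeq : (G.adjMatrix ℝ).mulVec b = graphRho G • b := by
    rw [← hi]; exact hA.mulVec_eigenvectorBasis i
  have hbne : b ≠ 0 := by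
    intro h
    apply hA.eigenvectorBasis.toBasis.ne_zero i
    simp only [OrthonormalBasis.coe_toBasis]
    ext v
    exact congrFun h v
  have hzero : star b ⬝ᵥ (algebraMap ℝ (Matrix V V ℝ) (graphRho G) -
      G.adjMatrix ℝ).mulVec b = 0 := by
    rw [Matrix.sub_mulVec, hbeq, Algebra.algebraMap_eq_smul_one, Matrix.smul_mulVec,
      Matrix.one_mulVec, sub_self, dotProduct_zero]
  -- Passing to absolute values cannot decrease the adjacency form, so `y` also annihilates the
  -- semidefinite form and lies in its kernel.
  set y : V → ℝ := fun v => |b v| with hy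
  have hyzero : star y ⬝ᵥ (algebraMap ℝ (Matrix V V ℝ) (graphRho G) -
      G.adjMatrix ℝ).mulVec y = 0 := by
    refine le_antisymm ?_ ((posSemidef_rho_sub_adjMatrix G).dotProduct_mulVec_nonneg y)
    rw [← hzero, dotProduct_rho_sub_adjMatrix, dotProduct_rho_sub_adjMatrix]
    simp only [hy, sq_abs]
    refine sub_le_sub_left (Finset.sum_le_sum fun u _ => Finset.sum_le_sum fun v _ => ?_) _
    split_ifs
    · rw [← abs_mul]; exact le_abs_self _
    · exact le_rfl
  have hyeq := ((posSemidef_rho_sub_adjMatrix G).dotProduct_mulVec_zero_iff y).1 hyzero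
  rw [Matrix.sub_mulVec, Algebra.algebraMap_eq_smul_one, Matrix.smul_mulVec,
      Matrix.one_mulVec, sub_eq_zero] at hyeq
  obtain ⟨z, -, hz⟩ := Finset.exists_max_image Finset.univ y Finset.univ_nonempty
  have hzpos : 0 < y z := by
    obtain ⟨v, hv⟩ := Function.ne_iff.1 hbne
    exact (abs_pos.2 hv).trans_le (hz v (Finset.mem_univ v))
  refine ⟨fun v => y v / y z, fun v => div_nonneg (abs_nonneg _) hzpos.le,
    fun v => (div_le_one hzpos).2 (hz v (Finset.mem_univ v)), ⟨z, div_self hzpos.ne'⟩, fun v => ?_⟩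
  have h1 := congrFun hyeq v
  simp only [Pi.smul_apply, smul_eq_mul, Matrix.mulVec, dotProduct,
    SimpleGraph.adjMatrix_apply, ite_mul, one_mul, zero_mul] at h1
  rw [← mul_div_assoc, h1, Finset.sum_div]
  refine Finset.sum_congr rfl fun u _ => ?_
  split_ifs <;> simp

theorem graphRho_congr {V' : Type*} [Fintype V'] {G : SimpleGraph V} {H : SimpleGraph V'}
    (e : G ≃g H) : graphRho G = graphRho H := by
  unfold graphRho
  rw [← AlgEquiv.spectrum_eq (Matrix.reindexAlgEquiv ℝ ℝ e.toEquiv)]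
  congr 2
  exact e.reindex_adjMatrix ℝ

end Spectral

/-! ### The spectral radius of a join -/

section Join

variable {V : Type*}

/-- The join of the complete graph on `K` and the empty graph on the other vertices. -/
def joinGraph (K : Finset V) : SimpleGraph V where
  Adj u v := u ≠ v ∧ (u ∈ K ∨ v ∈ K)
  symm := ⟨fun _ _ h => ⟨h.1.symm, h.2.symm⟩⟩
  loopless := ⟨fun _ h => h.1 rfl⟩

theorem sum_joinGraph_adj [Fintype V] (K : Finset V) (y : V → ℝ) :
    ∑ u, ∑ v, (if (joinGraph K).Adj u v then y u * y v else 0) =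
      (∑ u ∈ K, y u) ^ 2 - ∑ u ∈ K, y u ^ 2 + 2 * (∑ u ∈ K, y u) * ∑ u ∈ Kᶜ, y u := by
  have hK : ∀ u ∈ K, ∑ v, (if (joinGraph K).Adj u v then y u * y v else 0) =
      y u * (∑ v ∈ K, y v + ∑ v ∈ Kᶜ, y v) - y u ^ 2 := by
    intro u hu
    rw [Finset.sum_add_sum_compl, Finset.mul_sum, ← Finset.add_sum_erase _ _ (Finset.mem_univ u),
      ← Finset.add_sum_erase univ (fun v => y u * y v) (Finset.mem_univ u),
      if_neg ((joinGraph K).loopless.irrefl u)]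
    rw [Finset.sum_congr rfl (g := fun v => y u * y v)]
    · ring
    · intro v hv
      rw [if_pos ⟨(Finset.ne_of_mem_erase hv).symm, Or.inl hu⟩]
  have hK' : ∀ u ∈ Kᶜ, ∑ v, (if (joinGraph K).Adj u v then y u * y v else 0) =
      y u * ∑ v ∈ K, y v := by
    intro u hu
    rw [Finset.mem_compl] at hu
    rw [← Finset.sum_add_sum_compl K, Finset.mul_sum, Finset.sum_congr rfl (g := fun v => y u * y v),
      Finset.sum_eq_zero (s := Kᶜ), add_zero]
    · intro v hv
      rw [Finset.mem_compl] at hv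
      exact if_neg fun h => h.2.elim hu hv
    · intro v hv
      rw [if_pos ⟨by rintro rfl; exact hu hv, Or.inr hv⟩]
  rw [← Finset.sum_add_sum_compl K, Finset.sum_congr rfl hK, Finset.sum_congr rfl hK',
    Finset.sum_sub_distrib, ← Finset.sum_mul, ← Finset.sum_mul]
  ring

/-- The test vector is the Perron vector of the complete bipartite graph between `K` and its
complement; the edges inside `K` contribute nonnegatively. -/
theorem sqrt_le_rho_joinGraph [Fintype V] {K : Finset V} (hK : 0 < #K)
    (hKV : #K < Fintype.card V) :
    Real.sqrt (#K * (Fintype.card V - #K)) ≤ graphRho (joinGraph K) := by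
  set k : ℝ := (#K : ℝ) with hk
  set n : ℝ := (Fintype.card V : ℝ) with hn
  have hk0 : 0 < k := by rw [hk]; exact_mod_cast hK
  have hm0 : 0 < n - k := by rw [hk, hn, sub_pos]; exact_mod_cast hKV
  have h := sum_adj_le_rho_mul (joinGraph K)
    (fun v => if v ∈ K then Real.sqrt (n - k) else Real.sqrt k)
  rw [sum_joinGraph_adj, ← Finset.sum_add_sum_compl K (fun u => _ ^ 2)] at h
  have hcc : (#Kᶜ : ℝ) = n - k := by
    rw [Finset.card_compl, Nat.cast_sub hKV.le]
  have e1 : ∑ u ∈ K, (if u ∈ K then Real.sqrt (n - k) else Real.sqrt k) = k * √(n - k) := by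
    rw [Finset.sum_congr rfl (g := fun _ => √(n - k)) (fun u hu => if_pos hu)]; simp [hk]
  have e2 : ∑ u ∈ Kᶜ, (if u ∈ K then Real.sqrt (n - k) else Real.sqrt k) = (n - k) * √k := by
    rw [Finset.sum_congr rfl (g := fun _ => √k) (fun u hu => if_neg (Finset.mem_compl.1 hu))]
    simp [hcc]
  have e3 : ∑ u ∈ K, (if u ∈ K then Real.sqrt (n - k) else Real.sqrt k) ^ 2 = k * (n - k) := by
    rw [Finset.sum_congr rfl (g := fun _ => n - k)
      (fun u hu => by rw [if_pos hu, Real.sq_sqrt hm0.le]), Finset.sum_const, nsmul_eq_mul]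
  have e4 : ∑ u ∈ Kᶜ, (if u ∈ K then Real.sqrt (n - k) else Real.sqrt k) ^ 2 = (n - k) * k := by
    rw [Finset.sum_congr rfl (g := fun _ => k)
      (fun u hu => by rw [if_neg (Finset.mem_compl.1 hu), Real.sq_sqrt hk0.le])]; simp [hcc]
  rw [e1, e2, e3, e4] at h
  have h5 : (k * √(n - k)) ^ 2 = k ^ 2 * (n - k) := by rw [mul_pow, Real.sq_sqrt hm0.le]
  rw [h5] at h
  rw [Real.sqrt_mul hk0.le]
  have hk1 : 1 ≤ k := by rw [hk]; exact_mod_cast hK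
  have h6 : 0 ≤ k ^ 2 * (n - k) - k * (n - k) := by nlinarith [mul_pos hk0 hm0]
  have h7 : (2 * (k * (n - k))) * (√k * √(n - k)) ≤
      (2 * (k * (n - k))) * graphRho (joinGraph K) := by nlinarith
  exact le_of_mul_le_mul_left h7 (by positivity)

theorem sum_ite_le_card {G : SimpleGraph V} {x : V → ℝ} (hx1 : ∀ v, x v ≤ 1) (S : Finset V) (w : V) :
    ∑ v ∈ S, (if G.Adj w v then x v else 0) ≤ #{v ∈ S | G.Adj w v} := by
  rw [← Finset.sum_filter, ← nsmul_one, ← Finset.sum_const]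
  exact Finset.sum_le_sum fun v _ => hx1 v

end Join

/-! ### Entries of the Perron vector in a sparse graph -/

section PerronEstimates

variable {V W : Type*} [Fintype V] [Fintype W] {G : SimpleGraph V} {F : SimpleGraph W}
  {x : V → ℝ} {lam : ℝ}

/-- Summing the eigenvalue equation bounds `lam * ∑ x v` by the degree sum, which is linear in the
order. Since `lam` grows with the order, large entries are rare. -/
theorem card_large_entries_le (hF : F.IsTree) (hG : F.Free G) (hx0 : ∀ v, 0 ≤ x v)
    (hx1 : ∀ v, x v ≤ 1) (hlam : 0 ≤ lam)
    (hx : ∀ v, lam * x v = ∑ u, if G.Adj v u then x u else 0) (σ : ℝ) :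
    σ * lam * #{v | σ ≤ x v} ≤ 2 * Fintype.card W * Fintype.card V := by
  calc σ * lam * #{v | σ ≤ x v} = ∑ v with σ ≤ x v, lam * σ := by
        rw [Finset.sum_const, nsmul_eq_mul]; ring
    _ ≤ ∑ v with σ ≤ x v, lam * x v :=
        Finset.sum_le_sum fun v hv =>
          mul_le_mul_of_nonneg_left (Finset.mem_filter.1 hv).2 hlam
    _ ≤ ∑ v, lam * x v :=
        Finset.sum_le_sum_of_subset_of_nonneg (Finset.filter_subset _ _)
          fun v _ _ => mul_nonneg hlam (hx0 v)
    _ ≤ ∑ v, (#{u | G.Adj v u} : ℝ) :=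
        Finset.sum_le_sum fun v _ => by rw [hx v]; exact sum_ite_le_card hx1 univ v
    _ ≤ _ := by simpa using sum_card_adj_le hF hG univ

/-- Counting walks of length two, with the contribution of large entries separated. -/
theorem sq_mul_perron_le (hF : F.IsTree) (hG : F.Free G) (hx0 : ∀ v, 0 ≤ x v)
    (hx1 : ∀ v, x v ≤ 1) (hx : ∀ v, lam * x v = ∑ u, if G.Adj v u then x u else 0)
    {σ : ℝ} (hσ : 0 ≤ σ) {L : Finset V} (hL : ∀ v, v ∉ L → x v ≤ σ) (u : V) :
    lam ^ 2 * x u ≤ ∑ w with G.Adj u w ∧ w ∉ L, ∑ v ∈ L, (if G.Adj w v then x v else 0) +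
      2 * Fintype.card W * #L + 2 * Fintype.card W * σ * Fintype.card V := by
  have hLL : ∑ w ∈ L, (#{v ∈ L | G.Adj w v} : ℝ) ≤ 2 * Fintype.card W * #L :=
    sum_card_adj_le hF hG L
  have hall : ∑ w, (#{v | G.Adj w v} : ℝ) ≤ 2 * Fintype.card W * Fintype.card V := by
    simpa using sum_card_adj_le hF hG univ
  have hstep : ∀ w, lam * x w ≤ ∑ v ∈ L, (if G.Adj w v then x v else 0) +
      σ * #{v | G.Adj w v} := by
    intro w
    rw [hx w, ← Finset.sum_add_sum_compl L]
    refine add_le_add_right ?_ _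
    calc ∑ v ∈ Lᶜ, (if G.Adj w v then x v else 0)
        ≤ ∑ v ∈ Lᶜ, (if G.Adj w v then σ else 0) := by
          refine Finset.sum_le_sum fun v hv => ?_
          split_ifs
          · exact hL v (Finset.mem_compl.1 hv)
          · exact le_rfl
      _ ≤ ∑ v, (if G.Adj w v then σ else 0) :=
          Finset.sum_le_sum_of_subset_of_nonneg (Finset.subset_univ _) fun v _ _ => by
            split_ifs <;> simp [hσ]
      _ = σ * #{v | G.Adj w v} := by
          rw [← Finset.sum_filter, Finset.sum_const, nsmul_eq_mul, mul_comm]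
  have hnn : ∀ w, 0 ≤ ∑ v ∈ L, (if G.Adj w v then x v else 0) := fun w =>
    Finset.sum_nonneg fun v _ => by split_ifs; exacts [hx0 v, le_rfl]
  -- Walks `u, w, v` are split by type: an endpoint `v` outside `L` costs at most `σ` per edge, and
  -- walks with `w` and `v` both in `L` are paid for by the few edges inside `L`.
  calc lam ^ 2 * x u = ∑ w with G.Adj u w, lam * x w := by
        rw [pow_two, mul_assoc, hx u, Finset.sum_filter, Finset.mul_sum]
        exact Finset.sum_congr rfl fun w _ => by split_ifs <;> simp
    _ ≤ ∑ w with G.Adj u w, (∑ v ∈ L, (if G.Adj w v then x v else 0) + σ * #{v | G.Adj w v}) :=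
        Finset.sum_le_sum fun w _ => hstep w
    _ = (∑ w with G.Adj u w ∧ w ∉ L, ∑ v ∈ L, (if G.Adj w v then x v else 0) +
        ∑ w with G.Adj u w ∧ w ∈ L, ∑ v ∈ L, (if G.Adj w v then x v else 0)) +
        ∑ w with G.Adj u w, σ * #{v | G.Adj w v} := by
        rw [Finset.sum_add_distrib, ← Finset.sum_filter_add_sum_filter_not _ (fun w => w ∉ L),
          Finset.filter_filter, Finset.filter_filter]
        simp only [not_not]
    _ ≤ _ := by
        have h1 : ∑ w with G.Adj u w ∧ w ∈ L, ∑ v ∈ L, (if G.Adj w v then x v else 0) ≤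
            ∑ w ∈ L, (#{v ∈ L | G.Adj w v} : ℝ) := by
          calc _ ≤ ∑ w ∈ L, ∑ v ∈ L, (if G.Adj w v then x v else 0) :=
                Finset.sum_le_sum_of_subset_of_nonneg
                  (fun w hw => (Finset.mem_filter.1 hw).2.2) fun w _ _ => hnn w
            _ ≤ _ := Finset.sum_le_sum fun w _ => sum_ite_le_card hx1 L w
        have h2 : ∑ w with G.Adj u w, σ * (#{v | G.Adj w v} : ℝ) ≤
            2 * Fintype.card W * σ * Fintype.card V := by
          calc _ ≤ ∑ w, σ * (#{v | G.Adj w v} : ℝ) :=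
                Finset.sum_le_sum_of_subset_of_nonneg (Finset.filter_subset _ _)
                  fun w _ _ => by positivity
            _ = σ * ∑ w, (#{v | G.Adj w v} : ℝ) := by rw [Finset.mul_sum]
            _ ≤ _ := by nlinarith
        linarith

theorem le_card_common_neighbors {δ : ℝ} (K : Finset V)
    (hK : ∀ u ∈ K, (1 - δ) * Fintype.card V ≤ #{v | G.Adj u v}) :
    (1 - #K * δ) * Fintype.card V ≤ #{v | ∀ u ∈ K, G.Adj u v} := by
  have h1 : ({v | ∀ u ∈ K, G.Adj u v} : Finset V)ᶜ ⊆
      K.biUnion fun u => ({v | G.Adj u v} : Finset V)ᶜ := by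
    intro v hv
    simpa using hv
  have h2 : (#({v | ∀ u ∈ K, G.Adj u v} : Finset V)ᶜ : ℝ) ≤
      ∑ u ∈ K, (#({v | G.Adj u v} : Finset V)ᶜ : ℝ) := by
    exact_mod_cast (Finset.card_le_card h1).trans Finset.card_biUnion_le
  have h3 : ∀ s : Finset V, (#sᶜ : ℝ) = Fintype.card V - #s := fun s => by
    rw [Finset.card_compl, Nat.cast_sub (Finset.card_le_univ s)]
  have h4 : ∑ u ∈ K, (#({v | G.Adj u v} : Finset V)ᶜ : ℝ) ≤ ∑ u ∈ K, δ * Fintype.card V :=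
    Finset.sum_le_sum fun u hu => by rw [h3]; have := hK u hu; linarith
  rw [Finset.sum_const, nsmul_eq_mul] at h4
  rw [h3] at h2
  linarith

end PerronEstimates

/-! ### The dominating set of large entries -/

section Structure

variable {V W : Type*} [Fintype V] [Fintype W] {G : SimpleGraph V} {F : SimpleGraph W}
  {x : V → ℝ} {lam : ℝ} {k : ℕ}

set_option maxHeartbeats 1000000 in
/-- If the Perron vector belongs to a large eigenvalue, then its large entries are those of `k`
vertices adjacent to almost all vertices. -/
theorem exists_dominating_set (hF : F.IsTree) (hG : F.Free G) (hk : 1 ≤ k)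
    (hW : Fintype.card W ≤ 2 * k + 3) (hx0 : ∀ v, 0 ≤ x v) (hx1 : ∀ v, x v ≤ 1)
    (hz : ∃ z, x z = 1) (hx : ∀ v, lam * x v = ∑ u, if G.Adj v u then x u else 0)
    {c σ : ℝ} (hc : c = 2 * k + 3) (hσ : σ = 1 / (1152 * c ^ 3))
    (hlam : 2 * c / σ ^ 2 ≤ lam) (hlam2 : (k : ℝ) * (Fintype.card V - k) ≤ lam ^ 2)
    (hn : (k : ℝ) ^ 2 ≤ σ * Fintype.card V) (hn' : 4 * c ≤ Fintype.card V) :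
    ∃ K : Finset V, #K = k ∧ (∀ v ∈ K, 1 - 1 / (8 * c) ≤ x v) ∧
      (∀ v, v ∉ K → x v ≤ 1 / (8 * c)) ∧
      ∀ v ∈ K, (1 - 1 / (8 * c)) * Fintype.card V ≤ #{u | G.Adj v u} := by
  obtain ⟨A, hA, hAcard⟩ := hF.exists_colorClass ∅
  simp only [Finset.sdiff_empty, Finset.card_empty, add_zero] at hAcard
  have hAk : #A ≤ k + 1 := by omega
  have hk1 : (1 : ℝ) ≤ k := by exact_mod_cast hk
  have hc5 : 5 ≤ c := by rw [hc]; linarith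
  have hc0 : 0 < c := by linarith
  have hσ0 : 0 < σ := by rw [hσ]; positivity
  have hkc : (k : ℝ) ≤ c / 2 := by rw [hc]; linarith
  have hWc : (Fintype.card W : ℝ) ≤ c := by rw [hc]; exact_mod_cast hW
  set n : ℝ := (Fintype.card V : ℝ) with hndef
  have hn0 : 0 < n := by linarith
  have hlam0 : 0 < lam := lt_of_lt_of_le (by positivity) hlam
  -- `τ = c σ` is the basic error term
  obtain ⟨τ, hτ⟩ : ∃ τ, τ = c * σ := ⟨_, rfl⟩
  have hτ0 : 0 < τ := by rw [hτ]; positivity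
  obtain ⟨β, hβ⟩ : ∃ β, β = 1 / (8 * c) := ⟨_, rfl⟩
  have hβ0 : 0 < β := by rw [hβ]; positivity
  have hβc : β * c = 1 / 8 := by rw [hβ]; field_simp
  have hτβ : τ = β ^ 2 / 18 := by rw [hτ, hσ, hβ]; field_simp; norm_num
  have hβ40 : β ≤ 1 / 40 := by
    rw [hβ]; exact one_div_le_one_div_of_le (by norm_num) (by linarith)
  have hτβ' : τ ≤ β / 720 := by
    have : β * β ≤ β * (1 / 40) := by gcongr
    rw [hτβ, pow_two]; linarith
  have hστ : σ ≤ τ := by rw [hτ]; exact le_mul_of_one_le_left hσ0.le (by linarith)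
  rw [← hβ]
  set L : Finset V := {v | σ ≤ x v} with hL
  have hLcard : (#L : ℝ) ≤ σ * n := by
    have h1 := card_large_entries_le hF hG hx0 hx1 hlam0.le hx σ
    rw [← hL, ← hndef] at h1
    have h2 : 2 * c ≤ σ ^ 2 * lam := by
      rw [div_le_iff₀ (by positivity)] at hlam; linarith
    have h3 : σ * lam * #L ≤ σ * lam * (σ * n) := by
      calc σ * lam * #L ≤ 2 * Fintype.card W * n := h1
        _ ≤ 2 * c * n := by gcongr
        _ ≤ (σ ^ 2 * lam) * n := by gcongr
        _ = _ := by ring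
    exact le_of_mul_le_mul_left h3 (by positivity)
  have hLsmall : ∀ v, v ∉ L → x v ≤ σ := by
    intro v hv
    by_contra h
    exact hv (by simpa [hL] using (not_le.1 h).le)
  have herr : 2 * Fintype.card W * (#L : ℝ) + 2 * Fintype.card W * σ * n ≤ 4 * τ * n := by
    have e1 : (Fintype.card W : ℝ) * #L ≤ c * (σ * n) := by gcongr
    have e2 : (Fintype.card W : ℝ) * (σ * n) ≤ c * (σ * n) := by gcongr
    rw [hτ]; linarith
  have hsq := sq_mul_perron_le hF hG hx0 hx1 hx hσ0.le hLsmall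
  have hbetween : ∀ Q : Finset V, Disjoint L Q →
      ∑ q ∈ Q, (#{p ∈ L | G.Adj q p} : ℝ) ≤ k * #Q + τ * n := by
    intro Q hQ
    have h1 := sum_card_adj_between_le hF hG hA hAk L Q hQ
    have h2 : ∑ q ∈ Q, (#{p ∈ L | G.Adj q p} : ℝ) ≤ k * #Q + Fintype.card W * #L := by
      exact_mod_cast h1
    have e1 : (Fintype.card W : ℝ) * #L ≤ c * (σ * n) := by gcongr
    rw [hτ]; linarith
  have hkn : (k : ℝ) ^ 2 ≤ τ * n := hn.trans (by gcongr)
  -- The two-step count compares `k (n - k) x u` with `k deg u + 5 τ n`; the loss `k ^ 2` is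
  -- absorbed in a sixth `τ n`.
  have hdeg : ∀ u, (x u - 6 * τ) * n ≤ #{v | G.Adj u v} := by
    intro u
    have h1 := hsq u
    have h2 : ∑ w with G.Adj u w ∧ w ∉ L, ∑ v ∈ L, (if G.Adj w v then x v else 0) ≤
        k * (#{v | G.Adj u v} : ℝ) + τ * n := by
      calc _ ≤ ∑ w with G.Adj u w ∧ w ∉ L, (#{v ∈ L | G.Adj w v} : ℝ) :=
            Finset.sum_le_sum fun w _ => sum_ite_le_card hx1 L w
        _ ≤ k * (#{w | G.Adj u w ∧ w ∉ L} : ℝ) + τ * n := by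
            refine hbetween _ (Finset.disjoint_left.2 fun w hw hw' => ?_)
            exact (Finset.mem_filter.1 hw').2.2 hw
        _ ≤ _ := by
            gcongr
            intro h; exact h.1
    have h3 : k * (n - k) * x u ≤ lam ^ 2 * x u := mul_le_mul_of_nonneg_right hlam2 (hx0 u)
    have h4 : (k : ℝ) ^ 2 * x u ≤ k ^ 2 := mul_le_of_le_one_right (by positivity) (hx1 u)
    have h5 : (k : ℝ) * (x u * n - #{v | G.Adj u v}) ≤ 6 * τ * n := by linarith
    have h6 : 0 < τ * n := by positivity
    by_contra! hcon
    have h7 : 1 * (x u * n - #{v | G.Adj u v}) ≤ k * (x u * n - #{v | G.Adj u v}) :=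
      mul_le_mul_of_nonneg_right hk1 (by linarith)
    linarith
  set e : V → ℝ := fun v => (#{w ∈ Lᶜ | G.Adj v w} : ℝ) with he
  have he_ge : ∀ v, (x v - 7 * τ) * n ≤ e v := by
    intro v
    have h1 : (#{w | G.Adj v w} : ℝ) ≤ e v + #L := by
      simp only [he]
      have : ({w | G.Adj v w} : Finset V) ⊆ {w ∈ Lᶜ | G.Adj v w} ∪ L := by
        intro w hw; simp at hw ⊢; tauto
      exact_mod_cast (Finset.card_le_card this).trans (Finset.card_union_le _ _)
    have h2 := hdeg v
    have h3 : σ * n ≤ τ * n := by gcongr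
    linarith
  have he0 : ∀ v, 0 ≤ e v := fun v => by simp only [he]; positivity
  have he_n : ∀ v, e v ≤ n := fun v => by simp only [he, hndef]; exact_mod_cast Finset.card_le_univ _
  have hswap : ∑ q ∈ Lᶜ, (#{p ∈ L | G.Adj q p} : ℝ) = ∑ v ∈ L, e v := by
    simp only [he, Finset.card_filter, Nat.cast_sum]
    rw [Finset.sum_comm]
    refine Finset.sum_congr rfl fun v _ => Finset.sum_congr rfl fun w _ => ?_
    rw [G.adj_comm]
  have hesum : ∑ v ∈ L, e v ≤ k * n + τ * n := by
    have h1 := hbetween Lᶜ disjoint_compl_right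
    have h2 : (#Lᶜ : ℝ) ≤ n := by rw [hndef]; exact_mod_cast Finset.card_le_univ _
    have h3 : (k : ℝ) * #Lᶜ ≤ k * n := by gcongr
    linarith
  have hxe : k * n - 5 * τ * n ≤ ∑ v ∈ L, x v * e v := by
    obtain ⟨z, hz⟩ := hz
    have h1 := hsq z
    rw [hz, mul_one] at h1
    have h2 : ∑ w with G.Adj z w ∧ w ∉ L, ∑ v ∈ L, (if G.Adj w v then x v else 0) ≤
        ∑ v ∈ L, x v * e v := by
      calc _ ≤ ∑ w ∈ Lᶜ, ∑ v ∈ L, (if G.Adj w v then x v else 0) := by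
            refine Finset.sum_le_sum_of_subset_of_nonneg
              (fun w hw => Finset.mem_compl.2 (Finset.mem_filter.1 hw).2.2) fun w _ _ =>
              Finset.sum_nonneg fun v _ => ?_
            split_ifs; exacts [hx0 v, le_rfl]
        _ = ∑ v ∈ L, x v * e v := by
            rw [Finset.sum_comm]
            refine Finset.sum_congr rfl fun v _ => ?_
            simp only [he]
            rw [← Finset.sum_filter, Finset.sum_const, nsmul_eq_mul, mul_comm]
            simp only [G.adj_comm]
    linarith
  -- The sums of `e v` and of `x v * e v` over `L` both lie within a few `τ n` of `k n`, so their
  -- difference, a sum of nonnegative terms, bounds each term.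
  have hdef : ∀ v ∈ L, (1 - x v) * e v ≤ 6 * τ * n := by
    intro v hv
    have h1 : (1 - x v) * e v ≤ ∑ v ∈ L, (1 - x v) * e v :=
      Finset.single_le_sum (f := fun v => (1 - x v) * e v)
        (fun v _ => mul_nonneg (sub_nonneg.2 (hx1 v)) (he0 v)) hv
    have h2 : ∑ v ∈ L, (1 - x v) * e v = ∑ v ∈ L, e v - ∑ v ∈ L, x v * e v := by
      rw [← Finset.sum_sub_distrib]; exact Finset.sum_congr rfl fun v _ => by ring
    linarith
  have hβL : ∀ v, β ≤ x v → v ∈ L := by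
    intro v hv
    simp only [hL, Finset.mem_filter, Finset.mem_univ, true_and]
    linarith
  -- A gap in the entries: `β ≤ x v` forces `e v ≥ β n / 2`, so `1 - x v ≤ 12 τ / β`. The constant
  -- in `σ` is chosen to make this `2 β / 3`.
  have hlarge : ∀ v, β ≤ x v → 1 - 2 / 3 * β ≤ x v := by
    intro v hv
    have h1 := hdef v (hβL v hv)
    have h2 := he_ge v
    have h3 : β / 2 * n ≤ e v :=
      (mul_le_mul_of_nonneg_right (by linarith) hn0.le).trans h2
    have h4 : (1 - x v) * (β / 2 * n) ≤ 6 * τ * n :=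
      (mul_le_mul_of_nonneg_left h3 (sub_nonneg.2 (hx1 v))).trans h1
    rw [hτβ] at h4
    have h5 : (β * n) * (1 - x v) ≤ (β * n) * (2 / 3 * β) := by linarith
    have := le_of_mul_le_mul_left h5 (by positivity)
    linarith
  have hdegK : ∀ v, β ≤ x v → (1 - β) * n ≤ #{u | G.Adj v u} := by
    intro v hv
    refine le_trans ?_ (hdeg v)
    have := hlarge v hv
    exact mul_le_mul_of_nonneg_right (by linarith) hn0.le
  set K : Finset V := {v | β ≤ x v} with hK
  have hKmem : ∀ v, v ∈ K ↔ β ≤ x v := by simp [hK]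
  have hKL : K ⊆ L := fun v hv => hβL v ((hKmem v).1 hv)
  -- Vertices outside `K` contribute at most `β (k + τ) n` to the weighted sum and those in `K` at
  -- most `n` each, so fewer than `k` vertices would not reach `(k - 5 τ) n`.
  have hKge : k ≤ #K := by
    have h1 : ∑ v ∈ L, x v * e v ≤ #K * n + β * (k * n + τ * n) := by
      rw [← Finset.sum_sdiff hKL, add_comm]
      refine add_le_add ?_ ?_
      · rw [← nsmul_eq_mul, ← Finset.sum_const]
        refine Finset.sum_le_sum fun v _ => ?_
        have := mul_le_mul (hx1 v) (he_n v) (he0 v) zero_le_one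
        linarith
      · calc ∑ v ∈ L \ K, x v * e v ≤ ∑ v ∈ L \ K, β * e v := by
              refine Finset.sum_le_sum fun v hv => mul_le_mul_of_nonneg_right ?_ (he0 v)
              have := (Finset.mem_sdiff.1 hv).2
              rw [hKmem] at this
              exact (not_le.1 this).le
          _ ≤ ∑ v ∈ L, β * e v := Finset.sum_le_sum_of_subset_of_nonneg Finset.sdiff_subset
              fun v _ _ => mul_nonneg hβ0.le (he0 v)
          _ = β * ∑ v ∈ L, e v := by rw [Finset.mul_sum]
          _ ≤ _ := by gcongr
    have h2 : β * k * n ≤ 1 / 16 * n := by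
      have : β * k ≤ β * (c / 2) := by gcongr
      gcongr; linarith
    have h2' : τ * n ≤ 1 / 100 * n := by gcongr; linarith
    have h2'' : β * (τ * n) ≤ 1 * (τ * n) := by gcongr; linarith
    have h3 : ((k : ℝ) - 1) * n < #K * n := by linarith
    have h4 : (k : ℝ) - 1 < #K := lt_of_mul_lt_mul_right h3 hn0.le
    have h5 : (k : ℝ) < #K + 1 := by linarith
    have h6 : k < #K + 1 := by exact_mod_cast h5
    omega
  -- With `k + 1` such vertices, at least half of all vertices would be common neighbours, which
  -- leaves room for `F` with `A` placed on them.
  have hKle : #K ≤ k := by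
    by_contra! hcon
    obtain ⟨K', hK'K, hK'card⟩ := Finset.exists_subset_card_eq (s := K) (n := k + 1) (by omega)
    have h1 := le_card_common_neighbors (G := G) (δ := β) K'
      (fun u hu => hdegK u ((hKmem u).1 (hK'K hu)))
    rw [hK'card, ← hndef] at h1
    push_cast at h1
    have h2 : ((k : ℝ) + 1) * β ≤ 1 / 2 := by
      have : ((k : ℝ) + 1) * β ≤ c * β := by gcongr; linarith
      linarith
    have h3 : 1 / 2 * n ≤ (1 - ((k : ℝ) + 1) * β) * n := by gcongr; linarith
    have h4 : (2 : ℝ) * Fintype.card W ≤ #{v | ∀ u ∈ K', G.Adj u v} := by linarith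
    refine hG (isContained_of_complete_bipartite (K := K')
      (R := ({v | ∀ u ∈ K', G.Adj u v} : Finset V)) hF ?_ (by exact_mod_cast h4) hA
      (by rw [hK'card]; exact hAk))
    intro u hu v hv
    exact (Finset.mem_filter.1 hv).2 u hu
  refine ⟨K, le_antisymm hKle hKge, ?_, ?_, ?_⟩
  · intro v hv
    have := hlarge v ((hKmem v).1 hv)
    linarith
  · intro v hv
    rw [hKmem] at hv
    exact (not_le.1 hv).le
  · exact fun v hv => hdegK v ((hKmem v).1 hv)

end Structure

/-! ### At most one edge among the common neighbours -/

section Uniqueness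

variable {V W : Type*} [Fintype W] {G : SimpleGraph V} {F : SimpleGraph W} {K R : Finset V}

theorem edge_unique_of_free (hF : F.IsTree) (hd : 3 ≤ F.diam) (hG : F.Free G)
    (hW : Fintype.card W ≤ 2 * #K + 3) (hKR : ∀ u ∈ K, ∀ v ∈ R, G.Adj u v)
    (hR : 2 * Fintype.card W ≤ #R) {a b a' b' : V} (ha : a ∈ R) (hb : b ∈ R) (ha' : a' ∈ R)
    (hb' : b' ∈ R) (hab : G.Adj a b) (hab' : G.Adj a' b') :
    a' = a ∧ b' = b ∨ a' = b ∧ b' = a := by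
  have hRK : ∀ u ∈ R, u ∉ K := fun u hu hu' => G.loopless.irrefl u (hKR u hu' u hu)
  have hch : ∀ v r r', v ∈ R → r ∈ R → r' ∈ R → G.Adj v r → G.Adj v r' → r = r' := by
    intro v r r' hv hr hr' h h'
    by_contra hne
    exact hG (isContained_of_cherry hF hW hKR hR (hRK v hv) hr hr' hne h h')
  by_cases h1 : a = a'
  · subst h1; exact Or.inl ⟨rfl, hch a b' b ha hb' hb hab' hab⟩
  by_cases h2 : b = b'
  · subst h2; exact absurd (hch b a a' hb ha ha' hab.symm hab'.symm) h1
  by_cases h3 : a = b'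
  · subst h3; exact Or.inr ⟨hch a a' b ha ha' hb hab'.symm hab, rfl⟩
  by_cases h4 : b = a'
  · subst h4; exact absurd (hch b a b' hb ha hb' hab.symm hab') h3
  exact absurd (isContained_of_two_edges hF hd hW hKR hR ha hb ha' hb' hab hab' h1 h2 h3 h4) hG

end Uniqueness

/-! ### From almost full degree to full degree -/

section Completion

variable {V : Type*} {G : SimpleGraph V} {x : V → ℝ} {lam s : ℝ}

/-- As a quadratic in `t`, `(s - lam t)² - lam t²` has minimum `-s² / (lam - 1)`, which exceeds
`-1/8` by the hypothesis on `lam`. Thus the product of two entries across an edge is paid for by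
their deviations from `s / lam`. -/
theorem sq_le_deviation {t : ℝ} {k : ℕ} (hs0 : 0 ≤ s) (hs : s ≤ k) (hlam : 8 * (k : ℝ) ^ 2 + 1 < lam) :
    t ^ 2 - 1 / (8 * lam) ≤ (s - lam * t) ^ 2 / lam := by
  have hlam1 : 0 < lam - 1 := by nlinarith [sq_nonneg (k : ℝ)]
  have hlam0 : 0 < lam := by linarith
  have hs2 : s ^ 2 ≤ k ^ 2 := by gcongr
  rw [le_div_iff₀ hlam0]
  have h1 : (t ^ 2 - 1 / (8 * lam)) * lam = t ^ 2 * lam - 1 / 8 := by field_simp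
  rw [h1]
  have h2 : 0 ≤ ((lam - 1) * lam * t - lam * s) ^ 2 := sq_nonneg _
  have h3 : 0 ≤ (lam * (lam - 1)) * ((s - lam * t) ^ 2 - t ^ 2 * lam + 1 / 8) := by
    have : (lam * (lam - 1)) * ((s - lam * t) ^ 2 - t ^ 2 * lam + 1 / 8) =
        ((lam - 1) * lam * t - lam * s) ^ 2 + lam * ((lam - 1) / 8 - s ^ 2) := by ring
    rw [this]
    have : 0 ≤ lam * ((lam - 1) / 8 - s ^ 2) := mul_nonneg hlam0.le (by linarith)
    linarith
  have h4 := nonneg_of_mul_nonneg_right h3 (by positivity)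
  linarith

/-- A single edge inside `R` contributes little to the quadratic form. -/
theorem sum_adj_le_deviation {R : Finset V} {k : ℕ}
    (hR : ∀ a ∈ R, ∀ b ∈ R, ∀ a' ∈ R, ∀ b' ∈ R, G.Adj a b → G.Adj a' b' →
      a' = a ∧ b' = b ∨ a' = b ∧ b' = a)
    (hs0 : 0 ≤ s) (hs : s ≤ k) (hlam : 8 * (k : ℝ) ^ 2 + 1 < lam) :
    ∑ u ∈ R, ∑ v ∈ R, (if G.Adj u v then x u * x v else 0) ≤
      ∑ u ∈ R, (s - lam * x u) ^ 2 / lam + 1 / (4 * lam) := by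
  have hlam0 : 0 < lam := by nlinarith [sq_nonneg (k : ℝ)]
  have hnn : 0 ≤ ∑ u ∈ R, (s - lam * x u) ^ 2 / lam := Finset.sum_nonneg fun u _ => by positivity
  by_cases hex : ∃ a ∈ R, ∃ b ∈ R, G.Adj a b
  · obtain ⟨a, ha, b, hb, hab⟩ := hex
    have h1 : ∑ u ∈ R, ∑ v ∈ R, (if G.Adj u v then x u * x v else 0) = 2 * (x a * x b) := by
      rw [← Finset.sum_product', ← Finset.sum_filter]
      have : (R ×ˢ R).filter (fun p => G.Adj p.1 p.2) = {(a, b), (b, a)} := by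
        ext ⟨u, v⟩
        simp only [Finset.mem_filter, Finset.mem_product, Finset.mem_insert, Finset.mem_singleton,
          Prod.mk.injEq]
        constructor
        · rintro ⟨⟨hu, hv⟩, huv⟩
          exact hR a ha b hb u hu v hv hab huv
        · rintro (⟨rfl, rfl⟩ | ⟨rfl, rfl⟩)
          exacts [⟨⟨ha, hb⟩, hab⟩, ⟨⟨hb, ha⟩, hab.symm⟩]
      rw [this, Finset.sum_pair (by simp [hab.ne])]
      ring
    have h2 : ∑ u ∈ ({a, b} : Finset V), (s - lam * x u) ^ 2 / lam ≤
        ∑ u ∈ R, (s - lam * x u) ^ 2 / lam :=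
      Finset.sum_le_sum_of_subset_of_nonneg (by intro u; simp; rintro (rfl | rfl) <;> assumption)
        fun u _ _ => by positivity
    rw [Finset.sum_pair hab.ne] at h2
    have h3 := sq_le_deviation (t := x a) hs0 hs hlam
    have h4 := sq_le_deviation (t := x b) hs0 hs hlam
    have h5 : 1 / (4 * lam) = 1 / (8 * lam) + 1 / (8 * lam) := by field_simp; norm_num
    rw [h1, h5]
    linarith [two_mul_le_add_sq (x a) (x b)]
  · push Not at hex
    rw [Finset.sum_eq_zero]
    · positivity
    · exact fun u hu => Finset.sum_eq_zero fun v hv => if_neg (hex u hu v hv)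

end Completion

section Completion

variable {V W : Type*} [Fintype V] [Fintype W] {G : SimpleGraph V} {F : SimpleGraph W}
  {x : V → ℝ} {lam : ℝ} {k : ℕ}

/-- Comparison of `G` with the join of `K` and the empty graph, through the Perron vector of `G`
flattened outside `K`. -/
theorem sum_joinGraph_comparison {K : Finset V} (hlam0 : 0 < lam)
    (hx : ∀ v, lam * x v = ∑ u, if G.Adj v u then x u else 0)
    (hrho : graphRho (joinGraph K) ≤ lam) :
    ∑ u ∈ K, ∑ v ∈ K, (if u ≠ v ∧ ¬ G.Adj u v then x u * x v else 0) +
      ∑ w ∈ Kᶜ, (((∑ u ∈ K, x u) - lam * x w) ^ 2 / lam +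
        2 * (x w * ((∑ u ∈ K, x u) - ∑ u ∈ K, if G.Adj w u then x u else 0))) ≤
    ∑ w ∈ Kᶜ, ∑ v ∈ Kᶜ, (if G.Adj w v then x w * x v else 0) := by
  set s := ∑ u ∈ K, x u with hs
  set q := ∑ u ∈ K, x u ^ 2 with hq
  set a : V → ℝ := fun w => ∑ u ∈ K, if G.Adj w u then x u else 0 with ha
  set b : V → ℝ := fun w => ∑ v ∈ Kᶜ, if G.Adj w v then x v else 0 with hb
  have hab : ∀ w, lam * x w = a w + b w := fun w => by
    rw [hx w, ← Finset.sum_add_sum_compl K]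
  -- In the join itself all Perron entries outside `K` equal `s / lam`, whence the flattened test
  -- vector. The Rayleigh inequality turns into a balance: missing edges at `K` and deviations from
  -- `s / lam` must be paid for by edges outside `K`.
  have hray := sum_adj_le_rho_mul (joinGraph K) (fun v => if v ∈ K then x v else s / lam)
  rw [sum_joinGraph_adj, ← Finset.sum_add_sum_compl K (fun u => _ ^ 2)] at hray
  have e1 : ∑ u ∈ K, (if u ∈ K then x u else s / lam) = s :=
    Finset.sum_congr rfl fun u hu => if_pos hu
  have e2 : ∑ u ∈ Kᶜ, (if u ∈ K then x u else s / lam) = #Kᶜ * (s / lam) := by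
    rw [Finset.sum_congr rfl (g := fun _ => s / lam) fun u hu => if_neg (Finset.mem_compl.1 hu),
      Finset.sum_const, nsmul_eq_mul]
  have e3 : ∑ u ∈ K, (if u ∈ K then x u else s / lam) ^ 2 = q :=
    Finset.sum_congr rfl fun u hu => by rw [if_pos hu]
  have e4 : ∑ u ∈ Kᶜ, (if u ∈ K then x u else s / lam) ^ 2 = #Kᶜ * (s / lam) ^ 2 := by
    rw [Finset.sum_congr rfl (g := fun _ => (s / lam) ^ 2)
      fun u hu => by rw [if_neg (Finset.mem_compl.1 hu)], Finset.sum_const, nsmul_eq_mul]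
  rw [e1, e2, e3, e4] at hray
  have hq0 : 0 ≤ q := Finset.sum_nonneg fun u _ => sq_nonneg _
  have hray' : s ^ 2 - q + 2 * s * (#Kᶜ * (s / lam)) ≤ lam * (q + #Kᶜ * (s / lam) ^ 2) :=
    hray.trans (mul_le_mul_of_nonneg_right hrho (by positivity))
  have hs2 : lam * (s / lam) ^ 2 = s ^ 2 / lam := by field_simp
  have hs3 : s * (s / lam) = s ^ 2 / lam := by ring
  have hmain : s ^ 2 - q + #Kᶜ * (s ^ 2 / lam) ≤ lam * q := by
    have : lam * (q + #Kᶜ * (s / lam) ^ 2) = lam * q + #Kᶜ * (lam * (s / lam) ^ 2) := by ring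
    rw [this, hs2] at hray'
    have : 2 * s * (#Kᶜ * (s / lam)) = 2 * (#Kᶜ * (s * (s / lam))) := by ring
    rw [this, hs3] at hray'
    linarith
  have hlq : lam * q = ∑ u ∈ K, ∑ v ∈ K, (if G.Adj u v then x u * x v else 0) +
      ∑ w ∈ Kᶜ, x w * a w := by
    have h1 : ∑ w ∈ Kᶜ, x w * a w = ∑ u ∈ K, x u * b u := by
      simp only [ha, hb, Finset.mul_sum]
      rw [Finset.sum_comm]
      refine Finset.sum_congr rfl fun u _ => Finset.sum_congr rfl fun w _ => ?_
      rw [G.adj_comm]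
      split_ifs
      · ring
      · simp
    have h2 : ∑ u ∈ K, ∑ v ∈ K, (if G.Adj u v then x u * x v else 0) = ∑ u ∈ K, x u * a u := by
      simp only [ha, Finset.mul_sum]
      refine Finset.sum_congr rfl fun u _ => Finset.sum_congr rfl fun w _ => ?_
      split_ifs <;> simp
    rw [h1, h2, ← Finset.sum_add_distrib, hq, Finset.mul_sum]
    refine Finset.sum_congr rfl fun u _ => ?_
    rw [← mul_add, ← hab u]; ring
  have hD : ∑ u ∈ K, ∑ v ∈ K, (if u ≠ v ∧ ¬ G.Adj u v then x u * x v else 0) =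
      s ^ 2 - q - ∑ u ∈ K, ∑ v ∈ K, (if G.Adj u v then x u * x v else 0) := by
    rw [pow_two, hs, Finset.sum_mul_sum, hq, ← Finset.sum_sub_distrib, ← Finset.sum_sub_distrib]
    refine Finset.sum_congr rfl fun u hu => ?_
    have : x u ^ 2 = ∑ v ∈ K, if u = v then x u * x v else 0 := by
      rw [Finset.sum_ite_eq, if_pos hu, pow_two]
    rw [this, ← Finset.sum_sub_distrib, ← Finset.sum_sub_distrib]
    refine Finset.sum_congr rfl fun v _ => ?_
    by_cases huv : u = v
    · subst huv; simp
    · by_cases hadj : G.Adj u v <;> simp [huv, hadj]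
  have hB : ∑ w ∈ Kᶜ, ∑ v ∈ Kᶜ, (if G.Adj w v then x w * x v else 0) = ∑ w ∈ Kᶜ, x w * b w := by
    simp only [hb, Finset.mul_sum]
    refine Finset.sum_congr rfl fun u _ => Finset.sum_congr rfl fun w _ => ?_
    split_ifs <;> simp
  have hterm : ∑ w ∈ Kᶜ, ((s - lam * x w) ^ 2 / lam + 2 * (x w * (s - a w))) =
      #Kᶜ * (s ^ 2 / lam) - ∑ w ∈ Kᶜ, x w * a w + ∑ w ∈ Kᶜ, x w * b w := by
    rw [← nsmul_eq_mul, ← Finset.sum_const, ← Finset.sum_sub_distrib, ← Finset.sum_add_distrib]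
    refine Finset.sum_congr rfl fun w _ => ?_
    have : (s - lam * x w) ^ 2 / lam = s ^ 2 / lam - 2 * (x w * s) + x w * (lam * x w) := by
      field_simp; ring
    rw [this, hab w]; ring
  rw [hD, hB, hterm]
  linarith

/-- A dominating set found from the Perron vector consists of vertices of full degree. -/
theorem adj_of_mem_dominating_set (hF : F.IsTree) (hd : 3 ≤ F.diam) (hG : F.Free G) (hk : 1 ≤ k)
    (hW : Fintype.card W ≤ 2 * k + 3) (hx0 : ∀ v, 0 ≤ x v) (hx1 : ∀ v, x v ≤ 1)
    (hx : ∀ v, lam * x v = ∑ u, if G.Adj v u then x u else 0)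
    {c : ℝ} (hc : c = 2 * k + 3) (hlam : 8 * (k : ℝ) ^ 2 + 1 < lam) {K : Finset V} (hK : #K = k)
    (hKx : ∀ v ∈ K, 3 / 4 ≤ x v) (hKx' : ∀ v, v ∉ K → x v ≤ 1 / (8 * c))
    (hR : 2 * Fintype.card W ≤ #{v | ∀ u ∈ K, G.Adj u v})
    (hrho : graphRho (joinGraph K) ≤ lam) :
    ∀ u ∈ K, ∀ v, u ≠ v → G.Adj u v := by
  -- In this balance the edges outside `K` bring at most half of `∑ x` over `E`, the deviations over
  -- `R`, and `1 / (4 lam)`. Every vertex of `E` costs its half of `x w` and `1 / (2 lam)` more, and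
  -- a nonadjacent pair inside `K` costs at least `9/16`; either is too much.
  by_contra! hcon
  have hk1 : (1 : ℝ) ≤ k := by exact_mod_cast hk
  have hlam0 : 0 < lam := by nlinarith
  have hlam1 : 1 < lam := by nlinarith
  have hc0 : 0 < c := by rw [hc]; positivity
  obtain ⟨β, hβ⟩ : ∃ β, β = 1 / (8 * c) := ⟨_, rfl⟩
  rw [← hβ] at hKx'
  have hβ0 : 0 < β := by rw [hβ]; positivity
  have hβc : β * c = 1 / 8 := by rw [hβ]; field_simp
  set R : Finset V := {v | ∀ u ∈ K, G.Adj u v} with hRdef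
  have hKR : ∀ u ∈ K, ∀ v ∈ R, G.Adj u v := fun u hu v hv => (Finset.mem_filter.1 hv).2 u hu
  have hRK : R ⊆ Kᶜ := fun u hu => Finset.mem_compl.2 fun hu' =>
    G.loopless.irrefl u (hKR u hu' u hu)
  have hWK : Fintype.card W ≤ 2 * #K + 3 := by rw [hK]; exact hW
  set E : Finset V := Kᶜ \ R with hE
  have hEK : ∀ v ∈ E, v ∉ K := fun v hv => Finset.mem_compl.1 (Finset.mem_sdiff.1 hv).1
  have hWc : (Fintype.card W : ℝ) ≤ c := by rw [hc]; exact_mod_cast hW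
  have hcomp := sum_joinGraph_comparison hlam0 hx hrho
  set s := ∑ u ∈ K, x u with hs
  have hs0 : 0 ≤ s := Finset.sum_nonneg fun u _ => hx0 u
  have hsk : s ≤ k := by
    calc s ≤ ∑ u ∈ K, (1 : ℝ) := Finset.sum_le_sum fun u _ => hx1 u
      _ = k := by simp [hK]
  have hs34 : 3 / 4 ≤ s := by
    calc (3 / 4 : ℝ) ≤ k * (3 / 4) := by linarith
      _ = ∑ u ∈ K, (3 / 4 : ℝ) := by rw [Finset.sum_const, hK, nsmul_eq_mul]
      _ ≤ s := Finset.sum_le_sum fun u hu => hKx u hu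
  -- the edges outside `K`
  have hRR := sum_adj_le_deviation (x := x) (R := R) (G := G)
    (fun a ha b hb a' ha' b' hb' h h' =>
      edge_unique_of_free hF hd hG hWK hKR hR ha hb ha' hb' h h') hs0 hsk hlam
  have hEE := sum_adj_mul_le hF hG (x := x) (η := β) E (fun v _ => hx0 v)
    (fun v hv => hKx' v (hEK v hv))
  have hER : ∑ w ∈ E, ∑ v ∈ R, (if G.Adj w v then x w * x v else 0) ≤ β * ∑ w ∈ E, x w := by
    rw [Finset.mul_sum]
    refine Finset.sum_le_sum fun w hw => ?_
    rw [← Finset.sum_filter]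
    -- Two neighbours in `R` would form a cherry with `w` as midpoint.
    have hone : #{v ∈ R | G.Adj w v} ≤ 1 := by
      refine Finset.card_le_one.2 fun r hr r' hr' => ?_
      rw [Finset.mem_filter] at hr hr'
      by_contra hne
      exact hG (isContained_of_cherry hF hWK hKR hR (hEK w hw) hr.1 hr'.1 hne hr.2 hr'.2)
    calc ∑ v ∈ R with G.Adj w v, x w * x v ≤ ∑ v ∈ R with G.Adj w v, x w * β := by
          refine Finset.sum_le_sum fun v hv => mul_le_mul_of_nonneg_left ?_ (hx0 w)
          exact hKx' v (Finset.mem_compl.1 (hRK (Finset.mem_filter.1 hv).1))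
      _ = #{v ∈ R | G.Adj w v} * (x w * β) := by rw [Finset.sum_const, nsmul_eq_mul]
      _ ≤ 1 * (x w * β) :=
          mul_le_mul_of_nonneg_right (by exact_mod_cast hone) (mul_nonneg (hx0 w) hβ0.le)
      _ = β * x w := by ring
  have hRE : ∑ w ∈ R, ∑ v ∈ E, (if G.Adj w v then x w * x v else 0) =
      ∑ w ∈ E, ∑ v ∈ R, (if G.Adj w v then x w * x v else 0) := by
    rw [Finset.sum_comm]
    exact Finset.sum_congr rfl fun w _ => Finset.sum_congr rfl fun v _ => by
      rw [G.adj_comm, mul_comm]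
  have hEx : 0 ≤ ∑ w ∈ E, x w := Finset.sum_nonneg fun w _ => hx0 w
  have hB : ∑ w ∈ Kᶜ, ∑ v ∈ Kᶜ, (if G.Adj w v then x w * x v else 0) ≤
      1 / 2 * ∑ w ∈ E, x w + (∑ u ∈ R, (s - lam * x u) ^ 2 / lam + 1 / (4 * lam)) := by
    have hsplit : ∑ w ∈ Kᶜ, ∑ v ∈ Kᶜ, (if G.Adj w v then x w * x v else 0) =
        (∑ w ∈ E, ∑ v ∈ E, (if G.Adj w v then x w * x v else 0) +
          ∑ w ∈ E, ∑ v ∈ R, (if G.Adj w v then x w * x v else 0)) +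
        (∑ w ∈ R, ∑ v ∈ E, (if G.Adj w v then x w * x v else 0) +
          ∑ w ∈ R, ∑ v ∈ R, (if G.Adj w v then x w * x v else 0)) := by
      rw [← Finset.sum_sdiff hRK, ← Finset.sum_add_distrib, ← Finset.sum_add_distrib]
      congr 1 <;> exact Finset.sum_congr rfl fun w _ => (Finset.sum_sdiff hRK).symm
    rw [hsplit, hRE]
    have h1 : 2 * Fintype.card W * β * ∑ w ∈ E, x w ≤ 2 * c * β * ∑ w ∈ E, x w := by gcongr
    have h2 : 2 * β ≤ 1 / 4 := by nlinarith
    have h3 : 2 * β * ∑ w ∈ E, x w ≤ 1 / 4 * ∑ w ∈ E, x w :=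
      mul_le_mul_of_nonneg_right h2 hEx
    have h4 : 2 * c * β * ∑ w ∈ E, x w = 1 / 4 * ∑ w ∈ E, x w := by
      have : 2 * c * β = 1 / 4 := by linarith
      rw [this]
    linarith
  -- the gain at the vertices that miss a vertex of `K`
  have ha_le : ∀ w, (∑ u ∈ K, if G.Adj w u then x u else 0) ≤ s := fun w =>
    Finset.sum_le_sum fun u _ => by split_ifs; exacts [le_rfl, hx0 u]
  have ha_E : ∀ w ∈ E, (∑ u ∈ K, if G.Adj w u then x u else 0) ≤ s - 3 / 4 := by
    intro w hw
    obtain ⟨u, hu, huw⟩ : ∃ u ∈ K, ¬ G.Adj u w := by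
      have := (Finset.mem_sdiff.1 hw).2
      simpa [hRdef] using this
    rw [hs, ← Finset.add_sum_erase K _ hu, ← Finset.add_sum_erase K x hu,
      if_neg (fun h => huw h.symm)]
    have h1 : (∑ u ∈ K.erase u, if G.Adj w u then x u else 0) ≤ ∑ u ∈ K.erase u, x u :=
      Finset.sum_le_sum fun u _ => by split_ifs; exacts [le_rfl, hx0 u]
    have := hKx u hu
    linarith
  have hgain : ∑ u ∈ R, (s - lam * x u) ^ 2 / lam + ∑ w ∈ E, (1 / (2 * lam) + 1 / 2 * x w) ≤
      ∑ w ∈ Kᶜ, ((s - lam * x w) ^ 2 / lam +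
        2 * (x w * (s - ∑ u ∈ K, if G.Adj w u then x u else 0))) := by
    rw [← Finset.sum_sdiff hRK, add_comm]
    refine add_le_add (Finset.sum_le_sum fun w hw => ?_) (Finset.sum_le_sum fun w _ => ?_)
    · have h1 : x w * (3 / 4) ≤ x w * (s - ∑ u ∈ K, if G.Adj w u then x u else 0) :=
        mul_le_mul_of_nonneg_left (by linarith [ha_E w hw]) (hx0 w)
      -- For `y = lam * x w`, the square of `s - y - 1/2` gives `(s - y)² + y ≥ s - 1/4`, and `s ≥
      -- 3/4`.
      have h2 : 1 / (2 * lam) ≤ (s - lam * x w) ^ 2 / lam + x w := by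
        have h3 : (s - lam * x w) ^ 2 / lam + x w = ((s - lam * x w) ^ 2 + lam * x w) / lam := by
          field_simp
        have h4 : 1 / (2 * lam) = (1 / 2) / lam := by field_simp
        rw [h3, h4]
        refine div_le_div_of_nonneg_right ?_ hlam0.le
        linarith [sq_nonneg (s - lam * x w - 1 / 2)]
      linarith
    · have := mul_nonneg (hx0 w) (sub_nonneg.2 (ha_le w))
      linarith
  rw [Finset.sum_add_distrib, Finset.sum_const, nsmul_eq_mul, ← Finset.mul_sum] at hgain
  have hD0 : ∀ u ∈ K, ∀ v ∈ K, 0 ≤ (if u ≠ v ∧ ¬ G.Adj u v then x u * x v else 0) := by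
    intro u _ v _
    split_ifs
    exacts [mul_nonneg (hx0 u) (hx0 v), le_rfl]
  have hD : 0 ≤ ∑ u ∈ K, ∑ v ∈ K, (if u ≠ v ∧ ¬ G.Adj u v then x u * x v else 0) :=
    Finset.sum_nonneg fun u hu => Finset.sum_nonneg fun v hv => hD0 u hu v hv
  have hquarter : 1 / (4 * lam) = (1 / 4) * (1 / lam) := by field_simp
  have hhalf : 1 / (2 * lam) = (1 / 2) * (1 / lam) := by field_simp
  have hil : 0 < 1 / lam := by positivity
  have hil1 : 1 / lam < 1 := by rw [div_lt_one hlam0]; exact hlam1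
  rw [hquarter] at hB
  rw [hhalf] at hgain
  obtain ⟨u, hu, v, huv, hadj⟩ := hcon
  by_cases hv : v ∈ K
  · have h1 : x u * x v ≤ ∑ u ∈ K, ∑ v ∈ K, (if u ≠ v ∧ ¬ G.Adj u v then x u * x v else 0) := by
      refine le_trans ?_ (Finset.single_le_sum
        (f := fun u => ∑ v ∈ K, (if u ≠ v ∧ ¬ G.Adj u v then x u * x v else 0))
        (fun u hu => Finset.sum_nonneg fun v hv => hD0 u hu v hv) hu)
      refine le_trans (le_of_eq ?_) (Finset.single_le_sum
        (f := fun v => (if u ≠ v ∧ ¬ G.Adj u v then x u * x v else 0))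
        (fun v hv => hD0 u hu v hv) hv)
      simp [huv, hadj]
    have h2 : (3 / 4 : ℝ) * (3 / 4) ≤ x u * x v :=
      mul_le_mul (hKx u hu) (hKx v hv) (by norm_num) (hx0 u)
    have h3 : 0 ≤ (#E : ℝ) * (1 / 2 * (1 / lam)) := by positivity
    linarith
  · have hvE : v ∈ E := Finset.mem_sdiff.2 ⟨Finset.mem_compl.2 hv, fun h => hadj (hKR u hu v h)⟩
    have h1 : (1 : ℝ) ≤ #E := by exact_mod_cast Finset.card_pos.2 ⟨v, hvE⟩
    have h2 : 1 * (1 / 2 * (1 / lam)) ≤ (#E : ℝ) * (1 / 2 * (1 / lam)) := by gcongr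
    linarith

end Completion

/-! ### Recognising the graphs `S_{n,k}^0` and `S_{n,k}^1` -/

section Isomorphisms

/-- A permutation of `Fin n` moving the first vertices onto a given set and the next two vertices
to given places. -/
theorem exists_perm_initial {n k : ℕ} {K : Finset (Fin n)} (hK : #K = k) {a b : Fin n}
    (ha : a ∉ K) (hb : b ∉ K) (hab : a ≠ b) :
    ∃ e : Fin n ≃ Fin n, (∀ i, e i ∈ K ↔ (i : ℕ) < k) ∧ (∀ i, e i = a ↔ (i : ℕ) = k) ∧
      ∀ i, e i = b ↔ (i : ℕ) = k + 1 := by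
  have hkn : k + 2 ≤ n := by
    have h1 := Finset.card_le_univ (insert a (insert b K))
    rw [Finset.card_insert_of_notMem (by simp [ha, hab]), Finset.card_insert_of_notMem hb, hK,
      Fintype.card_fin] at h1
    exact h1
  let f : Fin n → Fin n := fun i =>
    if h : (i : ℕ) < k then K.orderEmbOfFin hK ⟨i, h⟩ else if (i : ℕ) = k then a else b
  have hf1 : ∀ i : Fin n, (i : ℕ) < k → f i ∈ K := by
    intro i hi
    simp only [f, hi, dite_true]
    exact K.orderEmbOfFin_mem hK _
  have hf2 : ∀ i : Fin n, (i : ℕ) = k → f i = a := by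
    intro i hi
    simp [f, hi]
  have hf3 : ∀ i : Fin n, (i : ℕ) = k + 1 → f i = b := by
    intro i hi
    simp [f, hi]
  have hinj : Set.InjOn f ({i | (i : ℕ) < k + 2} : Finset (Fin n)) := by
    intro i hi j hj hij
    simp only [Finset.coe_filter, Finset.mem_univ, true_and, Set.mem_ofPred_eq] at hi hj
    have h1 := hf1 i
    have h2 := hf2 i
    have h3 := hf3 i
    have h4 := hf1 j
    have h5 := hf2 j
    have h6 := hf3 j
    by_cases hik : (i : ℕ) < k
    · by_cases hjk : (j : ℕ) < k
      · simp only [f, hik, hjk, dite_true] at hij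
        have := (K.orderEmbOfFin hK).injective hij
        rw [Fin.mk.injEq] at this
        exact Fin.ext this
      · have : (j : ℕ) = k ∨ (j : ℕ) = k + 1 := by omega
        grind
    · have hi' : (i : ℕ) = k ∨ (i : ℕ) = k + 1 := by omega
      by_cases hjk : (j : ℕ) < k
      · grind
      · have : (j : ℕ) = k ∨ (j : ℕ) = k + 1 := by omega
        apply Fin.ext
        grind
  obtain ⟨g, hg⟩ := Finset.exists_equiv_extend_of_card_eq (α := Fin n) (t := (univ : Finset (Fin n)))
    (by simp) (f := f) (Finset.subset_univ _) hinj
  let e : Fin n ≃ Fin n := g.trans (Equiv.subtypeUnivEquiv (fun x => Finset.mem_univ x))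
  have he : ∀ i : Fin n, (i : ℕ) < k + 2 → e i = f i := fun i hi => hg i (by simpa using hi)
  have hea : ∀ i : Fin n, (i : ℕ) = k → e i = a := fun i hi => by
    rw [he i (by omega), hf2 i hi]
  have heb : ∀ i : Fin n, (i : ℕ) = k + 1 → e i = b := fun i hi => by
    rw [he i (by omega), hf3 i hi]
  have heK : ({i | (i : ℕ) < k} : Finset (Fin n)).image e = K := by
    refine Finset.eq_of_subset_of_card_le ?_ ?_
    · intro v hv
      obtain ⟨i, hi, rfl⟩ := Finset.mem_image.1 hv
      have hi : (i : ℕ) < k := by simpa using hi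
      rw [he i (by omega)]
      exact hf1 i hi
    · rw [Finset.card_image_of_injective _ e.injective, Fin.card_filter_val_lt, hK]
      omega
  refine ⟨e, fun i => ?_, fun i => ⟨fun h => ?_, hea i⟩, fun i => ⟨fun h => ?_, heb i⟩⟩
  · rw [← heK, Finset.mem_image]
    constructor
    · rintro ⟨j, hj, hji⟩
      obtain rfl := e.injective hji
      simpa using hj
    · intro h
      exact ⟨i, by simpa using h, rfl⟩
  · rw [← hea ⟨k, by omega⟩ rfl] at h
    rw [e.injective h]
  · rw [← heb ⟨k + 1, by omega⟩ rfl] at h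
    rw [e.injective h]

variable {n k : ℕ} {K : Finset (Fin n)} {G : SimpleGraph (Fin n)}

theorem nonempty_iso_graphS_zero (hK : #K = k) (hkn : k + 2 ≤ n)
    (hG : ∀ u v, G.Adj u v ↔ u ≠ v ∧ (u ∈ K ∨ v ∈ K)) : Nonempty (G ≃g graphS n k 0) := by
  have hcard : 1 < #Kᶜ := by rw [Finset.card_compl, Fintype.card_fin, hK]; omega
  obtain ⟨a, ha, b, hb, hab⟩ := Finset.one_lt_card.1 hcard
  obtain ⟨e, he, -, -⟩ := exists_perm_initial hK (Finset.mem_compl.1 ha) (Finset.mem_compl.1 hb) hab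
  refine ⟨(RelIso.symm ⟨e, fun {i j} => ?_⟩ : G ≃g graphS n k 0)⟩
  rw [hG, he, he, e.injective.ne_iff]
  simp [graphS]

theorem nonempty_iso_graphS_one (hK : #K = k) {a b : Fin n} (ha : a ∉ K) (hb : b ∉ K)
    (hab : a ≠ b) (hG : ∀ u v, G.Adj u v ↔
      u ≠ v ∧ (u ∈ K ∨ v ∈ K ∨ u = a ∧ v = b ∨ v = a ∧ u = b)) :
    Nonempty (G ≃g graphS n k 1) := by
  obtain ⟨e, he, hea, heb⟩ := exists_perm_initial hK ha hb hab
  refine ⟨(RelIso.symm ⟨e, fun {i j} => ?_⟩ : G ≃g graphS n k 1)⟩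
  rw [hG, he, he, hea, heb, hea, heb, e.injective.ne_iff]
  simp [graphS]

end Isomorphisms

/-! ### Structure and comparison of extremal candidates -/

section Main

/-- For large `n`, a graph of large spectral radius without some tree of order at most `2k + 3`
has `k` vertices of full degree. -/
theorem exists_full_set {k : ℕ} (hk : 1 ≤ k) : ∃ N : ℕ, ∀ {l : ℕ} (F : SimpleGraph (Fin l)),
    F.IsTree → 3 ≤ F.diam → l ≤ 2 * k + 3 → ∀ n, N ≤ n → ∀ G : SimpleGraph (Fin n),
    F.Free G → graphRho (graphS n k 0) ≤ graphRho G →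
    k + 2 * l ≤ n ∧ ∃ K : Finset (Fin n), #K = k ∧ ∀ u ∈ K, ∀ v, u ≠ v → G.Adj u v := by
  obtain ⟨c, hc⟩ : ∃ c : ℝ, c = 2 * k + 3 := ⟨_, rfl⟩
  obtain ⟨σ, hσ⟩ : ∃ σ : ℝ, σ = 1 / (1152 * c ^ 3) := ⟨_, rfl⟩
  have hk1 : (1 : ℝ) ≤ k := by exact_mod_cast hk
  have hc0 : 0 < c := by rw [hc]; positivity
  have hσ0 : 0 < σ := by rw [hσ]; positivity
  set M : ℝ := max (2 * c / σ ^ 2) (8 * (k : ℝ) ^ 2 + 2) with hM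
  have hM0 : 0 ≤ M := le_max_of_le_right (by positivity)
  -- The terms `k + M ^ 2` make `√(n - k)`, and so the spectral radius, at least `M`; `k ^ 2 / σ`
  -- and `4 * c` supply the size conditions of `exists_dominating_set`, and `4 * c` the room `k + 2
  -- * l ≤ n`.
  refine ⟨⌈k + M ^ 2 + k ^ 2 / σ + 4 * c⌉₊, fun {l} F hF hd hl n hn G hG hrho => ?_⟩
  have hn : k + M ^ 2 + k ^ 2 / σ + 4 * c ≤ n := Nat.ceil_le.1 hn
  have hkσ : 0 ≤ k ^ 2 / σ := by positivity
  have hM2 : 0 ≤ M ^ 2 := by positivity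
  have hlc : (l : ℝ) ≤ c := by rw [hc]; exact_mod_cast hl
  have hkn2 : k + 2 * l ≤ n := by
    have : (k : ℝ) + 2 * l ≤ n := by linarith
    exact_mod_cast this
  have hlpos : 0 < l := by
    obtain ⟨w⟩ := hF.connected.nonempty
    exact w.pos
  refine ⟨hkn2, ?_⟩
  have : Nonempty (Fin n) := ⟨⟨0, by omega⟩⟩
  have hjoin : ∀ K : Finset (Fin n), #K = k → graphRho (joinGraph K) = graphRho (graphS n k 0) :=
    fun K hK => by
      obtain ⟨e⟩ := nonempty_iso_graphS_zero (G := joinGraph K) hK (by omega) fun u v => Iff.rfl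
      exact graphRho_congr e
  have hsqrt : Real.sqrt (k * (n - k)) ≤ graphRho G := by
    obtain ⟨K, -, hK⟩ := Finset.exists_subset_card_eq (s := (univ : Finset (Fin n))) (n := k)
      (by simp; omega)
    have := sqrt_le_rho_joinGraph (K := K) (by omega) (by simp; omega)
    rw [hjoin K hK, hK, Fintype.card_fin] at this
    exact this.trans hrho
  have hnk : 0 ≤ (n : ℝ) - k := by linarith
  have hlam0 : 0 ≤ graphRho G := (Real.sqrt_nonneg _).trans hsqrt
  have hlam2 : (k : ℝ) * (n - k) ≤ graphRho G ^ 2 := by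
    rw [← Real.sq_sqrt (mul_nonneg (by positivity) hnk)]
    gcongr
  have hlamM : M ≤ graphRho G := by
    refine le_trans (Real.le_sqrt_of_sq_le ?_) hsqrt
    have : 1 * ((n : ℝ) - k) ≤ k * (n - k) := by gcongr
    linarith
  obtain ⟨x, hx0, hx1, hz, hx⟩ := exists_perron_vector G
  obtain ⟨K, hK, hKx, hKx', hKdeg⟩ := exists_dominating_set hF hG hk (by simpa using hl) hx0 hx1
    hz hx hc hσ ((le_max_left _ _).trans hlamM) (by simpa using hlam2)
    (by
      have : (k : ℝ) ^ 2 / σ ≤ n := by linarith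
      rw [div_le_iff₀ hσ0] at this
      rw [Fintype.card_fin]; linarith)
    (by rw [Fintype.card_fin]; linarith)
  have hβc : 1 / (8 * c) * c = 1 / 8 := by field_simp
  have hβ : 1 / (8 * c) ≤ 1 / 4 := one_div_le_one_div_of_le (by norm_num) (by rw [hc]; linarith)
  refine ⟨K, hK, adj_of_mem_dominating_set hF hd hG hk (by simpa using hl) hx0 hx1 hx hc ?_ hK
    (fun v hv => by linarith [hKx v hv]) hKx' ?_ (by rw [hjoin K hK]; exact hrho)⟩
  · exact lt_of_lt_of_le (by linarith) ((le_max_right (2 * c / σ ^ 2) _).trans hlamM)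
  · have h1 := le_card_common_neighbors K hKdeg
    rw [hK, Fintype.card_fin] at h1
    have h2 : (k : ℝ) * (1 / (8 * c)) ≤ c * (1 / (8 * c)) := by
      gcongr; rw [hc]; linarith
    have h3 : 1 / 2 * (n : ℝ) ≤ (1 - k * (1 / (8 * c))) * n := by
      gcongr; linarith
    rw [Fintype.card_fin, ← Nat.cast_le (α := ℝ)]
    push_cast
    refine le_trans ?_ h1
    linarith

variable {n k : ℕ}

/-- The Perron vector of the smaller graph is positive outside the clique, so the extra edge
strictly increases its Rayleigh quotient. This rules out `S_{n,k}^0` when `S_{n,k}^1` is also free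
of the tree. -/
theorem graphRho_graphS_zero_lt_one (hk : 1 ≤ k) (hkn : k + 2 ≤ n) :
    graphRho (graphS n k 0) < graphRho (graphS n k 1) := by
  have : Nonempty (Fin n) := ⟨⟨0, by omega⟩⟩
  set K : Finset (Fin n) := {i | (i : ℕ) < k} with hKdef
  have hmem : ∀ i, i ∈ K ↔ (i : ℕ) < k := by simp [hKdef]
  have hadj0 : ∀ i j, (graphS n k 0).Adj i j ↔ i ≠ j ∧ (i ∈ K ∨ j ∈ K) := by
    intro i j; rw [hmem, hmem]; simp [graphS]
  have heq : graphS n k 0 = joinGraph K := by ext i j; exact hadj0 i j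
  have hKcard : #K = k := by rw [hKdef, Fin.card_filter_val_lt]; omega
  have hpos : 0 < graphRho (graphS n k 0) := by
    rw [heq]
    refine lt_of_lt_of_le (Real.sqrt_pos.2 ?_)
      (sqrt_le_rho_joinGraph (K := K) (by omega) (by simp; omega))
    rw [hKcard, Fintype.card_fin]
    have h1 : (1 : ℝ) ≤ k := by exact_mod_cast hk
    have h2 : (k : ℝ) + 2 ≤ n := by exact_mod_cast hkn
    exact mul_pos (by linarith) (by linarith)
  obtain ⟨x, hx0, -, ⟨z, hz⟩, hx⟩ := exists_perron_vector (graphS n k 0)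
  set lam := graphRho (graphS n k 0) with hlam
  have hout : ∀ v, v ∉ K → lam * x v = ∑ u ∈ K, x u := by
    intro v hv
    rw [hx v, ← Finset.sum_filter]
    congr 1
    ext u
    simp only [Finset.mem_filter, Finset.mem_univ, true_and, hadj0, hv, false_or]
    exact ⟨fun h => h.2, fun h => ⟨by rintro rfl; exact hv h, h⟩⟩
  have hs : 0 < ∑ u ∈ K, x u := by
    refine lt_of_le_of_ne (Finset.sum_nonneg fun u _ => hx0 u) fun h => ?_
    have h1 : ∀ u ∈ K, x u = 0 :=
      (Finset.sum_eq_zero_iff_of_nonneg fun u _ => hx0 u).1 h.symm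
    by_cases hzK : z ∈ K
    · have := h1 z hzK; linarith
    · have := hout z hzK
      rw [← h, hz] at this
      linarith
  have hxpos : ∀ v, v ∉ K → 0 < x v := by
    intro v hv
    have h1 := hout v hv
    by_contra hcon
    have h2 : x v = 0 := le_antisymm (not_lt.1 hcon) (hx0 v)
    rw [h2, mul_zero] at h1
    linarith
  let a : Fin n := ⟨k, by omega⟩
  let b : Fin n := ⟨k + 1, by omega⟩
  have haK : a ∉ K := by simp [hmem, a]
  have hbK : b ∉ K := by simp [hmem, b]
  have hab : (graphS n k 1).Adj a b := by
    simp [graphS, a, b]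
  have hab0 : ¬ (graphS n k 0).Adj a b := by rw [hadj0]; tauto
  have hmono : ∀ u v, (graphS n k 0).Adj u v → (graphS n k 1).Adj u v := by
    intro u v h
    obtain ⟨hne, h | h | ⟨t, ht, -⟩⟩ := h
    · exact ⟨hne, Or.inl h⟩
    · exact ⟨hne, Or.inr (Or.inl h)⟩
    · omega
  have hterm : ∀ u v, (if (graphS n k 0).Adj u v then x u * x v else 0) ≤
      (if (graphS n k 1).Adj u v then x u * x v else 0) := by
    intro u v
    have := mul_nonneg (hx0 u) (hx0 v)
    by_cases h : (graphS n k 0).Adj u v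
    · rw [if_pos h, if_pos (hmono u v h)]
    · rw [if_neg h]; split_ifs <;> simp [this]
  have hlt : ∑ u, ∑ v, (if (graphS n k 0).Adj u v then x u * x v else 0) <
      ∑ u, ∑ v, (if (graphS n k 1).Adj u v then x u * x v else 0) := by
    refine Finset.sum_lt_sum (fun u _ => Finset.sum_le_sum fun v _ => hterm u v)
      ⟨a, Finset.mem_univ a, Finset.sum_lt_sum (fun v _ => hterm a v) ⟨b, Finset.mem_univ b, ?_⟩⟩
    rw [if_neg hab0, if_pos hab]
    exact mul_pos (hxpos a haK) (hxpos b hbK)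
  have heqn : ∑ u, ∑ v, (if (graphS n k 0).Adj u v then x u * x v else 0) =
      lam * ∑ u, x u ^ 2 := by
    rw [Finset.mul_sum]
    refine Finset.sum_congr rfl fun u _ => ?_
    rw [pow_two, mul_left_comm, hx u, Finset.mul_sum]
    exact Finset.sum_congr rfl fun v _ => by split_ifs <;> simp
  have hray := sum_adj_le_rho_mul (graphS n k 1) x
  rw [heqn] at hlt
  have hxx : 0 ≤ ∑ u, x u ^ 2 := Finset.sum_nonneg fun u _ => sq_nonneg _
  exact lt_of_mul_lt_mul_right (hlt.trans_le hray) hxx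

theorem SPEX_eq_of_unique {l : ℕ} {F : SimpleGraph (Fin l)} {G₀ : SimpleGraph (Fin n)}
    (hfree : F.Free G₀)
    (huniq : ∀ G : SimpleGraph (Fin n), F.Free G → graphRho G₀ ≤ graphRho G →
      Nonempty (G ≃g G₀)) :
    SPEX n F = {G | Nonempty (G ≃g G₀)} := by
  have hspex : spex n F = graphRho G₀ := by
    refine IsGreatest.csSup_eq ⟨⟨G₀, hfree, rfl⟩, ?_⟩
    rintro _ ⟨G, hG, rfl⟩
    by_contra! hcon
    obtain ⟨e⟩ := huniq G hG hcon.le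
    exact hcon.ne (graphRho_congr e).symm
  ext G
  constructor
  · rintro ⟨hG, hrho⟩
    exact huniq G hG (by rw [hrho, hspex])
  · rintro ⟨e⟩
    exact ⟨fun h => hfree (h.trans e.isContained), by rw [hspex]; exact graphRho_congr e⟩

/-- A graph with `k` vertices of full degree that lacks a tree of small order has at most one
further edge. -/
theorem iso_graphS_of_full_set {l : ℕ} {F : SimpleGraph (Fin l)} {G : SimpleGraph (Fin n)}
    (hF : F.IsTree) (hd : 3 ≤ F.diam) (hl : l ≤ 2 * k + 3) (hG : F.Free G) (hn : k + 2 * l ≤ n)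
    {K : Finset (Fin n)} (hK : #K = k) (hadj : ∀ u ∈ K, ∀ v, u ≠ v → G.Adj u v) :
    Nonempty (G ≃g graphS n k 0) ∨ Nonempty (G ≃g graphS n k 1) ∧
      (∃ R : Finset (Fin n), 2 * l ≤ #R ∧ (∀ u ∈ K, ∀ v ∈ R, G.Adj u v) ∧
        ∃ a ∈ R, ∃ b ∈ R, G.Adj a b) := by
  have hlpos : 0 < l := by
    obtain ⟨w⟩ := hF.connected.nonempty
    exact w.pos
  have hKR : ∀ u ∈ K, ∀ v ∈ Kᶜ, G.Adj u v := fun u hu v hv =>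
    hadj u hu v (by rintro rfl; exact (Finset.mem_compl.1 hv) hu)
  have hR : 2 * l ≤ #Kᶜ := by rw [Finset.card_compl, Fintype.card_fin, hK]; omega
  by_cases hex : ∃ a ∈ Kᶜ, ∃ b ∈ Kᶜ, G.Adj a b
  · refine Or.inr ⟨?_, Kᶜ, hR, hKR, hex⟩
    obtain ⟨a, ha, b, hb, hab⟩ := hex
    refine nonempty_iso_graphS_one hK (Finset.mem_compl.1 ha) (Finset.mem_compl.1 hb) hab.ne
      fun u v => ?_
    constructor
    · intro huv
      refine ⟨huv.ne, ?_⟩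
      by_cases hu : u ∈ K
      · exact Or.inl hu
      by_cases hv : v ∈ K
      · exact Or.inr (Or.inl hv)
      have := edge_unique_of_free hF hd hG (by rw [hK]; simpa using hl) hKR (by simpa using hR)
        ha hb (Finset.mem_compl.2 hu) (Finset.mem_compl.2 hv) hab huv
      tauto
    · rintro ⟨hne, hu | hv | ⟨rfl, rfl⟩ | ⟨rfl, rfl⟩⟩
      · exact hadj u hu v hne
      · exact (hadj v hv u hne.symm).symm
      · exact hab
      · exact hab.symm
  · push Not at hex
    refine Or.inl (nonempty_iso_graphS_zero hK (by omega) fun u v => ⟨fun huv => ?_, ?_⟩)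
    · refine ⟨huv.ne, ?_⟩
      by_contra! hcon
      exact hex u (Finset.mem_compl.2 hcon.1) v (Finset.mem_compl.2 hcon.2) huv
    · rintro ⟨hne, hu | hv⟩
      · exact hadj u hu v hne
      · exact (hadj v hv u hne.symm).symm

end Main

/-! ### The spider: a tree of every order and diameter -/

section Spider

/-- The parent of the vertex `j ≥ 1` in a path `0, …, d` with paths of length two, and possibly one
leaf, attached to the vertex `2`. -/
def spiderParent (d j : ℕ) : ℕ := if 2 < j ∧ d < j ∧ (j - d) % 2 = 1 then 2 else j - 1

/-- The tree on `0, …, l - 1` given by `spiderParent d`. -/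
def spider (l d : ℕ) : SimpleGraph (Fin l) where
  Adj i j := (0 < (j : ℕ) ∧ (i : ℕ) = spiderParent d j) ∨
    (0 < (i : ℕ) ∧ (j : ℕ) = spiderParent d i)
  symm := ⟨fun _ _ h => h.symm⟩
  loopless := ⟨fun i h => by
    have : 0 < (i : ℕ) ∧ (i : ℕ) = spiderParent d i := h.elim id id
    unfold spiderParent at this
    split_ifs at this <;> omega⟩

variable {l d : ℕ}

/-- The guard `2 < j` in `spiderParent` makes this true for every `d`, so following parents always
ends at `0`. -/
theorem spiderParent_lt {j : ℕ} (hj : 0 < j) : spiderParent d j < j := by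
  unfold spiderParent
  split_ifs <;> omega

theorem spider_adj_parent {i j : Fin l} (hj : 0 < (j : ℕ)) (hi : (i : ℕ) = spiderParent d j) :
    (spider l d).Adj i j := Or.inl ⟨hj, hi⟩

theorem spider_connected (hl : 0 < l) : (spider l d).Connected := by
  have hreach : ∀ m : ℕ, ∀ j : Fin l, (j : ℕ) = m → (spider l d).Reachable ⟨0, hl⟩ j := by
    intro m
    induction m using Nat.strong_induction_on with
    | _ m ih =>
      intro j hj
      rcases Nat.eq_zero_or_pos (j : ℕ) with h0 | h0
      · rw [show j = ⟨0, hl⟩ from Fin.ext h0]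
      · have hlt := spiderParent_lt (d := d) h0
        have hp : spiderParent d j < l := hlt.trans j.2
        exact (ih (spiderParent d j) (by omega) ⟨spiderParent d j, hp⟩ rfl).trans
          (spider_adj_parent (i := ⟨spiderParent d j, hp⟩) h0 rfl).reachable
  have : Nonempty (Fin l) := ⟨⟨0, hl⟩⟩
  exact ⟨fun u v => (hreach _ u rfl).symm.trans (hreach _ v rfl)⟩

theorem spider_isTree (hl : 0 < l) : (spider l d).IsTree := by
  have hconn := spider_connected (d := d) hl
  rw [SimpleGraph.isTree_iff_connected_and_card]
  refine ⟨hconn, le_antisymm ?_ hconn.card_vert_le_card_edgeSet_add_one⟩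
  let z : Fin l := ⟨0, hl⟩
  -- Every vertex but the root names the edge to its parent, so there are at most `l - 1` edges;
  -- `s(j, j)` is a default value that plays no role.
  let f : Fin l → Sym2 (Fin l) := fun j =>
    if h : spiderParent d j < l then s(⟨spiderParent d j, h⟩, j) else s(j, j)
  have hsub : (spider l d).edgeSet ⊆ ((univ.erase z).image f : Finset (Sym2 (Fin l))) := by
    intro e
    induction e using Sym2.ind with
    | _ i j =>
      intro h
      rw [SimpleGraph.mem_edgeSet] at h
      rw [Finset.mem_coe, Finset.mem_image]
      rcases h with ⟨h0, hi⟩ | ⟨h0, hi⟩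
      · refine ⟨j, by simp [z, Fin.ext_iff]; omega, ?_⟩
        have : spiderParent d j < l := hi ▸ i.2
        simp only [f, this, dite_true]
        congr 1
        simp [← hi]
      · refine ⟨i, by simp [z, Fin.ext_iff]; omega, ?_⟩
        have : spiderParent d i < l := hi ▸ j.2
        simp only [f, this, dite_true]
        rw [Sym2.eq_swap]
        congr 1
        simp [← hi]
  have h1 : Nat.card (spider l d).edgeSet ≤ #((univ.erase z).image f) := by
    rw [Nat.card_coe_set_eq, ← Set.ncard_coe_finset]
    exact Set.ncard_le_ncard hsub (Finset.finite_toSet _)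
  have h2 := h1.trans Finset.card_image_le
  rw [Finset.card_erase_of_mem (Finset.mem_univ z), Finset.card_univ, Fintype.card_fin] at h2
  rw [Nat.card_eq_fintype_card, Nat.card_eq_fintype_card, Fintype.card_fin] at *
  omega

theorem spider_diam (hd : 4 ≤ d) (hdl : d + 1 ≤ l) : (spider l d).diam = d := by
  have hl : 0 < l := by omega
  have hconn := spider_connected (l := l) (d := d) hl
  have : Nonempty (Fin l) := ⟨⟨0, hl⟩⟩
  have htop : (spider l d).ediam ≠ ⊤ := SimpleGraph.connected_iff_ediam_ne_top.1 hconn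
  have hpath : ∀ m : ℕ, ∀ i j : Fin l, (j : ℕ) ≤ d → (j : ℕ) = i + m →
      (spider l d).dist i j ≤ m := by
    intro m
    induction m with
    | zero =>
      intro i j _ hij
      rw [show i = j from Fin.ext (by omega), SimpleGraph.dist_self]
    | succ m ih =>
      intro i j hj hij
      let j' : Fin l := ⟨i + m, by omega⟩
      have h1 := ih i j' (by simp [j']; omega) rfl
      have h2 : (spider l d).Adj j' j := spider_adj_parent (by omega) (by
        unfold spiderParent; rw [if_neg (by omega)]; simp [j']; omega)
      have h3 := hconn.dist_triangle (u := i) (v := j') (w := j)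
      rw [SimpleGraph.dist_eq_one_iff_adj.2 h2] at h3
      omega
  let t : Fin l := ⟨2, by omega⟩
  have hhair : ∀ j : Fin l, d < (j : ℕ) → (spider l d).dist t j ≤ 2 := by
    intro j hj
    by_cases hodd : ((j : ℕ) - d) % 2 = 1
    · have : (spider l d).Adj t j := spider_adj_parent (by omega) (by
        unfold spiderParent; rw [if_pos (by omega)])
      rw [SimpleGraph.dist_eq_one_iff_adj.2 this]
      omega
    · let j' : Fin l := ⟨j - 1, by omega⟩
      have h1 : (spider l d).Adj j' j := spider_adj_parent (by omega) (by
        unfold spiderParent; rw [if_neg (by omega)])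
      have h2 : (spider l d).Adj t j' := spider_adj_parent (by simp [j']; omega) (by
        unfold spiderParent; rw [if_pos (by simp only [j']; omega)])
      have h3 := hconn.dist_triangle (u := t) (v := j') (w := j)
      rw [SimpleGraph.dist_eq_one_iff_adj.2 h1, SimpleGraph.dist_eq_one_iff_adj.2 h2] at h3
      omega
  have hcenter : ∀ j : Fin l, (spider l d).dist t j ≤ d - 2 := by
    intro j
    by_cases hj : (j : ℕ) ≤ d
    · by_cases hj2 : 2 ≤ (j : ℕ)
      · exact (hpath (j - 2) t j hj (by simp [t]; omega)).trans (by omega)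
      · rw [SimpleGraph.dist_comm]
        exact (hpath (2 - j) j t (by simp [t]; omega) (by simp [t]; omega)).trans (by omega)
    · exact (hhair j (by omega)).trans (by omega)
  apply le_antisymm
  · obtain ⟨u, v, huv⟩ := (spider l d).exists_dist_eq_diam
    rw [← huv]
    have htri := hconn.dist_triangle (u := u) (v := t) (w := v)
    have h1 := hcenter u
    have h2 := hcenter v
    rw [SimpleGraph.dist_comm] at h1
    by_cases hu : (u : ℕ) ≤ d
    · by_cases hv : (v : ℕ) ≤ d
      · rcases le_total (u : ℕ) v with h | h
        · exact (hpath (v - u) u v hv (by omega)).trans (by omega)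
        · rw [SimpleGraph.dist_comm]
          exact (hpath (u - v) v u hu (by omega)).trans (by omega)
      · have := hhair v (by omega)
        omega
    · have := hhair u (by omega)
      rw [SimpleGraph.dist_comm] at this
      omega
  -- Folding the legs onto the vertex `2` changes by at most one along an edge, so the ends `0` and
  -- `d` of the path are no closer in the tree.
  · let h : Fin l → ℕ := fun j => if (j : ℕ) ≤ d then j else 2
    have hlip : ∀ i j, (spider l d).Adj i j → h j ≤ h i + 1 := by
      intro i j hij
      simp only [h]
      rcases hij with ⟨h0, hi⟩ | ⟨h0, hi⟩ <;> unfold spiderParent at hi <;>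
        split_ifs at hi ⊢ <;> omega
    have hwalk : ∀ {i j : Fin l} (p : (spider l d).Walk i j), h j ≤ h i + p.length := by
      intro i j p
      induction p with
      | nil => simp
      | cons hadj p ih =>
        have := hlip _ _ hadj
        rw [SimpleGraph.Walk.length_cons]
        omega
    let a : Fin l := ⟨0, hl⟩
    let b : Fin l := ⟨d, by omega⟩
    obtain ⟨p, hp⟩ := hconn.exists_walk_length_eq_dist a b
    have h1 := hwalk p
    have h2 : h a = 0 := by simp [h, a]
    have h3 : h b = d := by simp [h, b]
    have h4 := SimpleGraph.dist_le_diam htop (u := a) (v := b)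
    omega

end Spider

/-! ### Matchings and vertex covers of the spider -/

section NotContained

variable {l n k : ℕ} {F : SimpleGraph (Fin l)}

theorem card_filter_lt_le {f : Fin l → Fin n} (hf : Function.Injective f) :
    #{v | (f v : ℕ) < k} ≤ k := by
  rw [← Finset.card_range k]
  refine Finset.card_le_card_of_injOn (fun v => (f v : ℕ)) ?_ ?_
  · intro v hv; simpa using hv
  · intro u _ v _ huv
    exact hf (Fin.ext huv)

/-- A graph with a matching of size `k + 1` is not contained in `S_{n,k}^0`. -/
theorem free_graphS_zero_of_matching (a b : ℕ → Fin l) (idx : Fin l → ℕ)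
    (hab : ∀ i ≤ k, F.Adj (a i) (b i)) (ha : ∀ i ≤ k, idx (a i) = i)
    (hb : ∀ i ≤ k, idx (b i) = i) : F.Free (graphS n k 0) := by
  rintro ⟨f⟩
  -- Every matching edge needs its own endpoint among the first `k` vertices; `idx` numbers the
  -- edges and thereby witnesses their disjointness.
  have hsub : Finset.range (k + 1) ⊆ ({v | (f v : ℕ) < k} : Finset (Fin l)).image idx := by
    intro i hi
    have hi : i ≤ k := by simpa [Nat.lt_succ_iff] using hi
    have hadj := f.toHom.map_adj (hab i hi)
    obtain ⟨-, h | h | ⟨t, ht, -⟩⟩ := hadj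
    · exact Finset.mem_image.2 ⟨a i, by simpa using h, ha i hi⟩
    · exact Finset.mem_image.2 ⟨b i, by simpa using h, hb i hi⟩
    · omega
  have h1 := (Finset.card_le_card hsub).trans Finset.card_image_le
  have h2 := card_filter_lt_le (k := k) (f := f) f.injective
  rw [Finset.card_range] at h1
  omega

/-- For odd `d` both the path and the legs respect the pairing of `2i` with `2i + 1`. -/
theorem spider_free_graphS_zero_of_odd {d : ℕ} (hd : Odd d) (hkl : 2 * k + 2 ≤ l) :
    (spider l d).Free (graphS n k 0) := by
  have hd2 := Nat.odd_iff.1 hd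
  refine free_graphS_zero_of_matching
    (fun i => if h : 2 * i < l then ⟨2 * i, h⟩ else ⟨0, by omega⟩)
    (fun i => if h : 2 * i + 1 < l then ⟨2 * i + 1, h⟩ else ⟨0, by omega⟩)
    (fun v => v / 2) ?_ ?_ ?_
  · intro i hi
    rw [dif_pos (by omega), dif_pos (by omega)]
    refine spider_adj_parent (by simp) ?_
    unfold spiderParent
    rw [if_neg (by simp only; omega)]
    simp
  · intro i hi
    rw [dif_pos (by omega)]
    simp
  · intro i hi
    rw [dif_pos (by omega)]
    simp only
    omega

/-- Here `l` and `d` are even, so the last vertex is a single leaf at `2`. The perfect matching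
consists of `{0, 1}`, `{2, l - 1}` and the pairs `{2i - 1, 2i}` with `2 ≤ i ≤ k`. -/
theorem spider_free_graphS_zero_of_even {d : ℕ} (hd4 : 4 ≤ d) (hd : Even d)
    (hkl : 2 * k + 2 = l) (hdl : d + 1 ≤ l) : (spider l d).Free (graphS n k 0) := by
  have hd2 := Nat.even_iff.1 hd
  refine free_graphS_zero_of_matching
    (fun i => if i = 0 then ⟨0, by omega⟩ else if i = 1 then ⟨2, by omega⟩ else
      if h : 2 * i - 1 < l then ⟨2 * i - 1, h⟩ else ⟨0, by omega⟩)
    (fun i => if i = 0 then ⟨1, by omega⟩ else if i = 1 then ⟨l - 1, by omega⟩ else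
      if h : 2 * i < l then ⟨2 * i, h⟩ else ⟨0, by omega⟩)
    (fun v => if (v : ℕ) ≤ 1 then 0 else if (v : ℕ) = 2 ∨ (v : ℕ) = l - 1 then 1 else (v + 1) / 2)
    ?_ ?_ ?_
  · intro i hi
    by_cases h0 : i = 0
    · rw [if_pos h0, if_pos h0]
      refine spider_adj_parent (by simp) ?_
      unfold spiderParent
      rw [if_neg (by simp only; omega)]
      rfl
    by_cases h1 : i = 1
    · rw [if_neg h0, if_neg h0, if_pos h1, if_pos h1]
      refine spider_adj_parent (by simp only; omega) ?_
      unfold spiderParent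
      rw [if_pos (by simp only; omega)]
    · rw [if_neg h0, if_neg h0, if_neg h1, if_neg h1, dif_pos (by omega), dif_pos (by omega)]
      refine spider_adj_parent (by simp only; omega) ?_
      unfold spiderParent
      rw [if_neg (by simp only; omega)]
  · intro i hi
    by_cases h0 : i = 0
    · simp [h0]
    by_cases h1 : i = 1
    · simp [h1]
    · rw [if_neg h0, if_neg h1, dif_pos (by omega)]
      simp only
      rw [if_neg (by omega), if_neg (by omega)]
      omega
  · intro i hi
    by_cases h0 : i = 0
    · simp [h0]
    by_cases h1 : i = 1
    · simp [h1]
      omega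
    · rw [if_neg h0, if_neg h1, dif_pos (by omega)]
      simp only
      rw [if_neg (by omega), if_neg (by omega)]
      omega

/-- For even `d`, a minimum vertex cover of the spider of order `2k + 3` avoids the even
vertices. -/
theorem spider_cover_avoids_even {d : ℕ} (hd : Even d) (hkl : 2 * k + 3 = l)
    {C : Finset (Fin l)} (hC : #C ≤ k + 1)
    (hcov : ∀ u v, (spider l d).Adj u v → u ∈ C ∨ v ∈ C) :
    ∀ v : Fin l, (v : ℕ) % 2 = 0 → v ∉ C := by
  have hd2 := Nat.even_iff.1 hd
  have hpair : ∀ u v : Fin l, (u : ℕ) % 2 = 1 → (v : ℕ) = u + 1 → (spider l d).Adj u v := by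
    intro u v hu hv
    refine spider_adj_parent (by omega) ?_
    unfold spiderParent
    rw [if_neg (by omega)]
    omega
  set idx : Fin l → ℕ := fun v => (v + 1) / 2 with hidx
  -- The `k + 1` disjoint edges `{2i - 1, 2i}` use up the whole cover: it has exactly one vertex on
  -- each and does not contain `0`.
  have hsub : Finset.Icc 1 (k + 1) ⊆ C.image idx := by
    intro i hi
    rw [Finset.mem_Icc] at hi
    rcases hcov ⟨2 * i - 1, by omega⟩ ⟨2 * i, by omega⟩
      (hpair _ _ (by simp only; omega) (by simp only; omega)) with h | h
    · exact Finset.mem_image.2 ⟨_, h, by simp only [hidx]; omega⟩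
    · exact Finset.mem_image.2 ⟨_, h, by simp only [hidx]; omega⟩
  have hle : #(C.image idx) ≤ #(Finset.Icc 1 (k + 1)) := by
    rw [Nat.card_Icc]
    exact Finset.card_image_le.trans (by omega)
  have heq := Finset.eq_of_subset_of_card_le hsub hle
  have hinj : Set.InjOn idx C := by
    rw [← Finset.card_image_iff]
    refine le_antisymm Finset.card_image_le ?_
    rw [← heq, Nat.card_Icc]
    omega
  have hmain : ∀ m : ℕ, ∀ v : Fin l, (v : ℕ) = m → (v : ℕ) % 2 = 0 → v ∉ C := by
    intro m
    induction m using Nat.strong_induction_on with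
    | _ m ih =>
      intro v hvm hv hvC
      rcases Nat.eq_zero_or_pos (v : ℕ) with h0 | h0
      · have := Finset.mem_image_of_mem idx hvC
        rw [← heq, Finset.mem_Icc] at this
        simp only [hidx] at this
        omega
      -- The odd partner `u` of `v` has an even parent `w`, uncovered by induction, so `u` lies in
      -- the cover and `v` cannot.
      · let u : Fin l := ⟨v - 1, by omega⟩
        have hu : (u : ℕ) = v - 1 := rfl
        have hlt := spiderParent_lt (d := d) (j := u) (by omega)
        let w : Fin l := ⟨spiderParent d u, by omega⟩
        have hw : (w : ℕ) = spiderParent d u := rfl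
        have hweven : (w : ℕ) % 2 = 0 := by
          rw [hw]
          unfold spiderParent
          split_ifs <;> omega
        have hwC := ih w (by omega) w rfl hweven
        have huC : u ∈ C := by
          rcases hcov w u (spider_adj_parent (by omega) hw) with h | h
          · exact absurd h hwC
          · exact h
        have := hinj huC hvC (by simp only [hidx]; omega)
        rw [Fin.ext_iff] at this
        omega
  exact fun v => hmain v v rfl

theorem spider_free_graphS_one {d : ℕ} (hd : Even d) (hkl : 2 * k + 3 = l) :
    (spider l d).Free (graphS n k 1) := by
  rintro ⟨f⟩
  have hd2 := Nat.even_iff.1 hd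
  set C : Finset (Fin l) := {v | (f v : ℕ) < k} with hCdef
  have hmem : ∀ v, v ∈ C ↔ (f v : ℕ) < k := by simp [hCdef]
  have hC : #C ≤ k := card_filter_lt_le f.injective
  have hedge : ∀ u v, (spider l d).Adj u v → u ∈ C ∨ v ∈ C ∨
      ((f u : ℕ) = k ∧ (f v : ℕ) = k + 1) ∨ ((f v : ℕ) = k ∧ (f u : ℕ) = k + 1) := by
    intro u v h
    obtain ⟨-, h | h | ⟨t, ht, h⟩⟩ := f.toHom.map_adj h
    · exact Or.inl ((hmem u).2 h)
    · exact Or.inr (Or.inl ((hmem v).2 h))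
    · obtain rfl : t = 0 := by omega
      exact Or.inr (Or.inr h)
  have hinj : ∀ u v : Fin l, (f u : ℕ) = f v → u = v := fun u v h => f.injective (Fin.ext h)
  have hpar : ∀ u v : Fin l, (spider l d).Adj u v → (u : ℕ) % 2 = 0 ∨ (v : ℕ) % 2 = 0 := by
    intro u v h
    rcases h with ⟨h0, hi⟩ | ⟨h0, hi⟩ <;> unfold spiderParent at hi <;> split_ifs at hi <;> omega
  -- The preimage `C` of the clique misses at most one edge of the spider, and every edge has an
  -- even end. Adding that end, or `0` if no edge is missed, would give a forbidden cover.
  have key : ∀ a : Fin l, (a : ℕ) % 2 = 0 →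
      (∀ u v, (spider l d).Adj u v → u ∈ insert a C ∨ v ∈ insert a C) → False := by
    intro a ha hcov
    refine spider_cover_avoids_even hd hkl (C := insert a C) ?_ hcov a ha
      (Finset.mem_insert_self a C)
    exact (Finset.card_insert_le a C).trans (by omega)
  by_cases hall : ∀ u v, (spider l d).Adj u v → u ∈ C ∨ v ∈ C
  · refine key ⟨0, by omega⟩ rfl fun u v h => ?_
    exact (hall u v h).imp (Finset.mem_insert_of_mem) (Finset.mem_insert_of_mem)
  · push Not at hall
    obtain ⟨u, v, huv, hu, hv⟩ := hall
    have hval : ((f u : ℕ) = k ∧ (f v : ℕ) = k + 1) ∨ ((f v : ℕ) = k ∧ (f u : ℕ) = k + 1) := by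
      have := hedge u v huv
      tauto
    have hother : ∀ u' v', (spider l d).Adj u' v' → u' ∈ C ∨ v' ∈ C ∨ (u' = u ∧ v' = v) ∨
        (u' = v ∧ v' = u) := by
      intro u' v' h'
      rcases hedge u' v' h' with h | h | h
      · exact Or.inl h
      · exact Or.inr (Or.inl h)
      · right; right
        rcases h with ⟨h1, h2⟩ | ⟨h1, h2⟩ <;> rcases hval with ⟨h3, h4⟩ | ⟨h3, h4⟩
        · exact Or.inl ⟨hinj _ _ (by omega), hinj _ _ (by omega)⟩
        · exact Or.inr ⟨hinj _ _ (by omega), hinj _ _ (by omega)⟩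
        · exact Or.inr ⟨hinj _ _ (by omega), hinj _ _ (by omega)⟩
        · exact Or.inl ⟨hinj _ _ (by omega), hinj _ _ (by omega)⟩
    rcases hpar u v huv with h | h
    · refine key u h fun u' v' h' => ?_
      have := hother u' v' h'
      simp only [Finset.mem_insert]
      tauto
    · refine key v h fun u' v' h' => ?_
      have := hother u' v' h'
      simp only [Finset.mem_insert]
      tauto

end NotContained

end SpectralTrees

theorem theorem1p2 (l d : ℕ) (hl : 6 ≤ l) (hd4 : 4 ≤ d) (hdl : d ≤ l - 1) :
    ∃ N : ℕ,
      ((Even l ∨ Even d) →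
        ∃ F : SimpleGraph (Fin l), F.IsTree ∧ F.diam = d ∧
          ∀ n : ℕ, N ≤ n →
            SPEX n F = {G : SimpleGraph (Fin n) | Nonempty (G ≃g graphGnl n l)}) ∧
      ((Odd l ∧ Odd d) →
        ∀ n : ℕ, N ≤ n → ∀ G : SimpleGraph (Fin n),
          graphRho (graphS n ((l - 3) / 2) 0) ≤ graphRho G →
            ((∀ F : SimpleGraph (Fin l), F.IsTree → F.diam = d → F ⊑ G) ↔
              ¬ Nonempty (G ≃g graphS n ((l - 3) / 2) 0))) := by
  obtain ⟨N₁, hN₁⟩ := exists_full_set (k := (l - 2) / 2) (by omega)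
  obtain ⟨N₂, hN₂⟩ := exists_full_set (k := (l - 3) / 2) (by omega)
  have htree := spider_isTree (l := l) (d := d) (by omega)
  have hdiam := spider_diam (l := l) hd4 (by omega)
  -- The bound `l + 2` leaves room for an edge outside the clique when `S_{n,k}^0` and `S_{n,k}^1`
  -- are compared.
  refine ⟨max (max N₁ N₂) (l + 2), fun hpar => ⟨spider l d, htree, hdiam, fun n hn => ?_⟩,
    fun hpar n hn G hrho => ⟨fun hall ⟨e⟩ => ?_, fun hiso F hF hFd => ?_⟩⟩
  · by_cases hle : Even l
    · have hl2 := Nat.even_iff.1 hle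
      rw [graphGnl, if_pos hle]
      refine SPEX_eq_of_unique ?_ fun G hG hrho => ?_
      · rcases Nat.even_or_odd d with hde | hdo
        · exact spider_free_graphS_zero_of_even hd4 hde (by omega) (by omega)
        · exact spider_free_graphS_zero_of_odd hdo (by omega)
      · obtain ⟨hkn, K, hK, hadj⟩ := hN₁ (spider l d) htree (by omega) (by omega) n (by omega) G hG
          hrho
        rcases iso_graphS_of_full_set htree (by omega) (by omega) hG hkn hK hadj with
          h | ⟨-, R, hR, hKR, a, ha, b, hb, hab⟩
        · exact h
        · exact absurd (isContained_of_edge_of_card_le htree (by omega)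
            (by rw [Fintype.card_fin]; omega) hKR (by simpa using hR) ha hb hab) hG
    · have hl2 := Nat.odd_iff.1 (Nat.not_even_iff_odd.1 hle)
      have hde : Even d := hpar.resolve_left hle
      rw [graphGnl, if_neg hle]
      have hlt := graphRho_graphS_zero_lt_one (k := (l - 3) / 2) (n := n) (by omega) (by omega)
      refine SPEX_eq_of_unique (spider_free_graphS_one hde (by omega)) fun G hG hrho => ?_
      obtain ⟨hkn, K, hK, hadj⟩ := hN₂ (spider l d) htree (by omega) (by omega) n (by omega) G hG
        (hlt.le.trans hrho)
      rcases iso_graphS_of_full_set htree (by omega) (by omega) hG hkn hK hadj with ⟨⟨e⟩⟩ | ⟨h, -⟩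
      · have := graphRho_congr e
        linarith
      · exact h
  · have hl2 := Nat.odd_iff.1 hpar.1
    refine spider_free_graphS_zero_of_odd (n := n) (k := (l - 3) / 2) hpar.2 (by omega)
      ((hall (spider l d) htree hdiam).trans e.isContained)
  · have hl2 := Nat.odd_iff.1 hpar.1
    by_contra hG
    obtain ⟨hkn, K, hK, hadj⟩ := hN₂ F hF (by omega) (by omega) n (by omega) G hG hrho
    rcases iso_graphS_of_full_set hF (by omega) (by omega) hG hkn hK hadj with
      h | ⟨-, R, hR, hKR, a, ha, b, hb, hab⟩
    · exact hiso h
    · exact hG (isContained_of_edge_of_odd_diam hF (hFd ▸ hpar.2)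
        (by rw [Fintype.card_fin]; omega) hKR (by simpa using hR) ha hb hab)
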